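/- Let $d\ge 4$. Let $X_1,X_2,\dots$ be independent random vectors, each uniformly distributed over the $2d$ unit vectors $\mathbf e_1,\dots,\mathbf e_d$, $\mathbf e_{d+j}=-\mathbf e_j$ $(1\le j\le d)$ of $\mathbb Z^d$, where $\mathbf e_1,\dots,\mathbf e_d$ is the standard basis, and let $S_n=X_1+\dots+X_n$, $S_0=0$, be the simple symmetric random walk. For $z\in\mathbb Z^d$ and $n\ge 0$ let $\xi(z,n)=\#\{k:0<k\le n,\ S_k=z\}$ be its local time, let $\gamma=\mathbf P(S_n\ne 0\text{ for all }n\ge 1)$ be the probability of never returning to the origin, let $\alpha=\frac{1-\gamma}{2-\gamma}$, and put $$\mathcal B=\{(x,y)\in\mathbb R^2: x\ge 0,\ y\ge 0,\ -(x+y)\log(x+y)+x\log x+y\log y-(x+y)\log\alpha\le 1\},$$ with the convention $0\log 0=0$. For $c\in\mathbb R$ write $c\,\mathcal B=\{(cx,cy):(x,y)\in\mathcal B\}$. Then for each $\varepsilon>0$, with probability 1 there exists a (random) $n_0=n_0(\varepsilon)$ such that for all $n\ge n_0$: (i) $(\xi(z,n),\xi(z+\mathbf e_i,n))\in((1+\varepsilon)\log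 n)\,\mathcal B$ for all $z\in\mathbb Z^d$ and all $i=1,\dots,2d$; (ii) for all integers $k,\ell\ge 0$ with $(k,\ell)\in((1-\varepsilon)\log n)\,\mathcal B$ and for every $i\in\{1,\dots,2d\}$ there exist (random) $z_1,z_2\in\mathbb Z^d$ such that $$(\xi(z_1,n),\xi(z_1+\mathbf e_i,n))=(k+1,\ell),\qquad (\xi(z_2,n),\xi(z_2+\mathbf e_i,n))=(k,\ell+1).$$ -/

import Mathlib

open MeasureTheory ProbabilityTheory
open scoped Pointwise

noncomputable section

namespace LocalTimes

/-- The integer lattice of dimension `d`. -/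
abbrev Lattice (d : ℕ) : Type := Fin d → ℤ

/-- The `2 * d` unit vectors of the lattice: the standard basis vectors and their negatives. -/
def unitVec {d : ℕ} : Fin d ⊕ Fin d → Lattice d
  | Sum.inl j => Pi.single j 1
  | Sum.inr j => -Pi.single j 1

/-- `X 0, X 1, X 2, …` are the successive steps of a simple symmetric random walk: they are
independent and each of them is uniformly distributed over the `2 * d` unit vectors. -/
structure IsSimpleWalkSteps {d : ℕ} {Ω : Type*} [MeasurableSpace Ω] (μ : Measure Ω)
    (X : ℕ → Ω → Lattice d) : Prop where
  measurable : ∀ k, Measurable (X k)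
  indep : iIndepFun X μ
  law : ∀ k i, μ.real {ω | X k ω = unitVec i} = 1 / (2 * (d : ℝ))

/-- The position of the walk at time `n`, started at the origin, with steps `X 0, X 1, …`. -/
def walk {d : ℕ} {Ω : Type*} (X : ℕ → Ω → Lattice d) (n : ℕ) (ω : Ω) : Lattice d :=
  ∑ k ∈ Finset.range n, X k ω

/-- The local time `ξ(z, n)`: the number of times `0 < k ≤ n` at which the walk is at `z`. -/
def localTime {d : ℕ} {Ω : Type*} (X : ℕ → Ω → Lattice d) (z : Lattice d) (n : ℕ) (ω : Ω) : ℕ :=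
  ((Finset.Ioc 0 n).filter (fun k => walk X k ω = z)).card

/-- The probability `γ` that the walk never returns to its starting point. -/
def escapeProb {d : ℕ} {Ω : Type*} [MeasurableSpace Ω] (μ : Measure Ω)
    (X : ℕ → Ω → Lattice d) : ℝ :=
  μ.real {ω | ∀ n, 1 ≤ n → walk X n ω ≠ 0}

/-- The set `{x, y ≥ 0 : -(x+y) log (x+y) + x log x + y log y - (x+y) log α ≤ 1}` with
`α = (1-γ)/(2-γ)`; the convention `0 log 0 = 0` is in force, since `Real.log 0 = 0`. -/
def regionB (γ : ℝ) : Set (ℝ × ℝ) :=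
  {v | 0 ≤ v.1 ∧ 0 ≤ v.2 ∧
    -(v.1 + v.2) * Real.log (v.1 + v.2) + v.1 * Real.log v.1 + v.2 * Real.log v.2
      - (v.1 + v.2) * Real.log ((1 - γ) / (2 - γ)) ≤ 1}

end LocalTimes

end

open scoped ENNReal

noncomputable section

namespace LocalTimes

/-! Consider the origin and a neighbour `u`. By symmetry and the first-step decomposition, the walk
hits `u` with the same probability `r = 1 - γ` with which it returns to `0`. Decomposing both
hitting probabilities along the first positive-time visit to `{0, u}` shows that this visit is to
`0`, and likewise to `u`, with probability `α = r / (1 + r)` (`pathLaw_firstVisit`). After each such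
visit the walk starts afresh, seen from its new position. The successive visits thus spell a word in
two letters, each of weight `α`, which ends with probability `1 - 2α`: the probability of ever
showing `k` and `l` visits is at most `(k + l choose k) α ^ (k + l)` (`pathLaw_reachEvent_le`).
Crude Stirling bounds identify this weight with `exp (-rate α k l)` up to polynomial factors, and
since `rate` is homogeneous of degree one, `c • 𝓑` with `c > 0` is its sublevel set at height `c`.
Up to time `n` there are at most about `n` starting points, so `log n` is the critical height.

Upper bound (`ae_eventually_rate_visits_le`): the counts for a pair of neighbours are counted from
the first time `j` at which the pair is visited. The probabilities of exceeding height `(1 + ε) log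
j` are summable over `j`, the counts and the direction, because part of the rate yields a power of
`j` below `-1` and the rest, by `mul_add_le_rate`, a geometric factor in the counts. Borel–Cantelli
then applies without passing to a subsequence of times.

Lower bound (`ae_eventually_exists_visits_eq`): time is cut into independent blocks of `2L` steps.
Within a block one asks that the middle site and its neighbour be new and then collect exactly the
prescribed visits. Time reversal turns newness into non-return, and a second moment bound makes some
block succeed (`measureReal_iInter_compl_le`). A local success is spoiled only by a visit at
distance at least `L` in time; in dimension at least four the heat kernel is `O(s ^ (-2))`, so this
costs a factor `O(1 / L)` (`exists_pathLaw_late_visit_le`), on top of the weight of the prescribed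
counts. With `L` a small power of the total time the failure probabilities are summable along powers
of two, and since a success persists for ever, the intermediate times need no argument. -/

/-- The uniform distribution over the unit vectors. -/
def stepLaw (d : ℕ) : Measure (Lattice d) :=
  ∑ i : Fin d ⊕ Fin d, (2 * (d : ℝ≥0∞))⁻¹ • Measure.dirac (unitVec i)

instance stepLaw_isProbabilityMeasure {d : ℕ} [NeZero d] : IsProbabilityMeasure (stepLaw d) := by
  constructor
  have hd : (d : ℝ≥0∞) ≠ 0 := by exact_mod_cast NeZero.ne d
  simp only [stepLaw, Measure.coe_finsetSum, Finset.sum_apply, Measure.smul_apply,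
    measure_univ, smul_eq_mul, mul_one, Finset.sum_const, Finset.card_univ, Fintype.card_sum,
    Fintype.card_fin, nsmul_eq_mul]
  push_cast
  rw [← two_mul]
  exact ENNReal.mul_inv_cancel (by simp [hd]) (by finiteness)

/-- The law of the sequence of steps of the simple symmetric random walk. -/
def pathLaw (d : ℕ) [NeZero d] : Measure (ℕ → Lattice d) :=
  Measure.infinitePi (fun _ => stepLaw d)

instance pathLaw_isProbabilityMeasure {d : ℕ} [NeZero d] : IsProbabilityMeasure (pathLaw d) := by
  unfold pathLaw; infer_instance

/-- The position at time `n` of the walk with steps `x`. -/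
def pos {d : ℕ} (x : ℕ → Lattice d) (n : ℕ) : Lattice d := ∑ k ∈ Finset.range n, x k

/-- The steps from time `m` on. -/
def shift {d : ℕ} (m : ℕ) (x : ℕ → Lattice d) : ℕ → Lattice d := fun k => x (m + k)

/-- The number of visits to `z` at the times `1, …, n` of the walk with steps `x`. -/
def visits {d : ℕ} (x : ℕ → Lattice d) (z : Lattice d) (n : ℕ) : ℕ :=
  ((Finset.Ioc 0 n).filter (fun k => pos x k = z)).card

/-- The set `A` of step sequences is determined by the first `m` steps. -/
def DeterminedBefore {d : ℕ} (m : ℕ) (A : Set (ℕ → Lattice d)) : Prop :=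
  ∀ x y, (∀ k < m, x k = y k) → x ∈ A → y ∈ A

/-! ### Deterministic path identities -/

section Basic

variable {d : ℕ}

lemma unitVec_injective : Function.Injective (unitVec : Fin d ⊕ Fin d → Lattice d) := by
  intro i j h
  rcases i with i | i <;> rcases j with j | j <;> simp only [unitVec] at h
  · have := congrFun h i
    by_contra hne
    have hij : i ≠ j := fun h => hne (by rw [h])
    simp [hij] at this
  · have := congrFun h i
    by_cases hij : i = j
    · subst hij; simp at this
    · simp [hij] at this
  · have := congrFun h i
    by_cases hij : i = j
    · subst hij; simp at this
    · simp [hij] at this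
  · have := congrFun h i
    by_contra hne
    have hij : i ≠ j := fun h => hne (by rw [h])
    simp [hij] at this

lemma unitVec_ne_zero (i : Fin d ⊕ Fin d) : unitVec i ≠ (0 : Lattice d) := by
  rcases i with i | i <;> simp [unitVec]

lemma unitVec_swap (i : Fin d ⊕ Fin d) : unitVec i.swap = -(unitVec i : Lattice d) := by
  rcases i with i | i <;> simp [unitVec]

@[simp] lemma pos_zero (x : ℕ → Lattice d) : pos x 0 = 0 := by simp [pos]

lemma pos_succ (x : ℕ → Lattice d) (n : ℕ) : pos x (n + 1) = pos x n + x n := by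
  simp [pos, Finset.sum_range_succ]

lemma pos_add (x : ℕ → Lattice d) (m n : ℕ) : pos x (m + n) = pos x m + pos (shift m x) n := by
  simp [pos, shift, Finset.sum_range_add]

lemma shift_shift (m n : ℕ) (x : ℕ → Lattice d) : shift n (shift m x) = shift (m + n) x := by
  funext k; simp [shift, add_assoc]

lemma pos_congr {x y : ℕ → Lattice d} {m n : ℕ} (h : ∀ k < m, x k = y k) (hn : n ≤ m) :
    pos x n = pos y n :=
  Finset.sum_congr rfl fun k hk => h k (by have := Finset.mem_range.1 hk; omega)

lemma visits_congr {x y : ℕ → Lattice d} {m n : ℕ} (h : ∀ k < m, x k = y k) (hn : n ≤ m)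
    (z : Lattice d) : visits x z n = visits y z n := by
  unfold visits
  congr 1
  refine Finset.filter_congr fun k hk => ?_
  rw [pos_congr h (by have := Finset.mem_Ioc.1 hk; omega)]

@[simp] lemma visits_zero (x : ℕ → Lattice d) (z : Lattice d) : visits x z 0 = 0 := by
  simp [visits]

lemma visits_add (x : ℕ → Lattice d) (z : Lattice d) (m n : ℕ) :
    visits x z (m + n) = visits x z m + visits (shift m x) (z - pos x m) n := by
  unfold visits
  have h : Finset.Ioc 0 (m + n) = Finset.Ioc 0 m ∪ Finset.Ioc m (m + n) :=
    (Finset.Ioc_union_Ioc_eq_Ioc (Nat.zero_le _) (Nat.le_add_right _ _)).symm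
  rw [h, Finset.filter_union, Finset.card_union_of_disjoint]
  · congr 1
    symm
    refine Finset.card_bij (fun k _ => m + k) ?_ (fun a _ b _ hab => by omega) ?_
    · intro k hk
      simp only [Finset.mem_filter, Finset.mem_Ioc] at hk ⊢
      refine ⟨by omega, ?_⟩
      rw [pos_add, hk.2]; abel
    · intro k hk
      simp only [Finset.mem_filter, Finset.mem_Ioc] at hk
      obtain ⟨j, rfl⟩ := Nat.exists_eq_add_of_le hk.1.1.le
      refine ⟨j, ?_, rfl⟩
      simp only [Finset.mem_filter, Finset.mem_Ioc]
      refine ⟨by omega, ?_⟩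
      rw [← hk.2, pos_add]; abel
  · refine Finset.disjoint_filter_filter ?_
    rw [Finset.disjoint_left]
    intro k hk hk'
    simp only [Finset.mem_Ioc] at hk hk'
    omega

lemma visits_eq_zero_iff (x : ℕ → Lattice d) (z : Lattice d) (n : ℕ) :
    visits x z n = 0 ↔ ∀ s, 0 < s → s ≤ n → pos x s ≠ z := by
  simp [visits, Finset.filter_eq_empty_iff]

lemma visits_succ (x : ℕ → Lattice d) (z : Lattice d) (n : ℕ) :
    visits x z (n + 1) = visits x z n + if pos x (n + 1) = z then 1 else 0 := by
  unfold visits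
  rw [← Finset.insert_Ioc_right_eq_Ioc_add_one (Nat.zero_le n), Finset.filter_insert]
  split_ifs with h
  · rw [Finset.card_insert_of_notMem (by simp)]
  · simp

end Basic

/-! ### The law of the steps and the Markov property -/

section Law

variable {d : ℕ}

lemma DeterminedBefore.mono {m n : ℕ} {A : Set (ℕ → Lattice d)} (h : DeterminedBefore m A)
    (hmn : m ≤ n) : DeterminedBefore n A :=
  fun x y hxy => h x y fun k hk => hxy k (hk.trans_le hmn)

lemma DeterminedBefore.inter {m : ℕ} {A B : Set (ℕ → Lattice d)} (hA : DeterminedBefore m A)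
    (hB : DeterminedBefore m B) : DeterminedBefore m (A ∩ B) :=
  fun x y hxy h => ⟨hA x y hxy h.1, hB x y hxy h.2⟩

lemma DeterminedBefore.shift {m n : ℕ} {A : Set (ℕ → Lattice d)} (hA : DeterminedBefore n A) :
    DeterminedBefore (m + n) (shift m ⁻¹' A) :=
  fun _ _ hxy h => hA _ _ (fun k hk => hxy (m + k) (by omega)) h

/-- Such a set is the preimage of its own image under restriction to the first `m` steps, and every
set of finite step sequences is countable, hence measurable. -/
lemma DeterminedBefore.measurableSet_iSup {m : ℕ} {A : Set (ℕ → Lattice d)}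
    (h : DeterminedBefore m A) :
    MeasurableSet[⨆ k ∈ {k : ℕ | k < m}, MeasurableSpace.comap (fun x : ℕ → Lattice d => x k)
      inferInstance] A := by
  set f : (ℕ → Lattice d) → (Fin m → Lattice d) := fun x k => x k with hf
  have hA : A = f ⁻¹' (f '' A) := by
    refine Set.Subset.antisymm (Set.subset_preimage_image _ _) ?_
    rintro y ⟨x, hx, hxy⟩
    exact h x y (fun k hk => congrFun hxy ⟨k, hk⟩) hx
  have hfm : @Measurable _ _ (⨆ k ∈ {k : ℕ | k < m},
      MeasurableSpace.comap (fun x : ℕ → Lattice d => x k) inferInstance) _ f := by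
    refine @measurable_pi_lambda _ _ _ (_) _ _ fun k => ?_
    rw [measurable_iff_comap_le]
    exact le_iSup₂_of_le (k : ℕ) k.2 le_rfl
  rw [hA]
  exact hfm (Set.to_countable _).measurableSet

lemma iSup_comap_eval_le (T : Set ℕ) :
    (⨆ k ∈ T, MeasurableSpace.comap (fun x : ℕ → Lattice d => x k) inferInstance) ≤
      MeasurableSpace.pi := by
  refine iSup₂_le fun k _ => ?_
  exact (measurable_pi_apply k).comap_le

lemma DeterminedBefore.measurableSet {m : ℕ} {A : Set (ℕ → Lattice d)}
    (h : DeterminedBefore m A) : MeasurableSet A :=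
  iSup_comap_eval_le _ _ h.measurableSet_iSup

@[fun_prop]
lemma measurable_shift (m : ℕ) : Measurable (shift m : (ℕ → Lattice d) → _) :=
  measurable_pi_lambda _ fun _ => measurable_pi_apply _

lemma stepLaw_singleton_unitVec (i : Fin d ⊕ Fin d) :
    stepLaw d {unitVec i} = (2 * (d : ℝ≥0∞))⁻¹ := by
  classical
  simp only [stepLaw, Measure.coe_finsetSum, Finset.sum_apply, Measure.smul_apply,
    smul_eq_mul]
  rw [Finset.sum_eq_single i]
  · simp
  · intro j _ hj
    have : unitVec j ≠ (unitVec i : Lattice d) := fun h => hj (unitVec_injective h)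
    simp [this]
  · simp

lemma stepLaw_map {g : Lattice d → Lattice d} (e : Fin d ⊕ Fin d ≃ Fin d ⊕ Fin d)
    (hg : ∀ i, g (unitVec i) = unitVec (e i)) : (stepLaw d).map g = stepLaw d := by
  have hm : Measurable g := measurable_of_countable g
  refine Measure.ext fun s hs => ?_
  rw [Measure.map_apply hm hs]
  simp only [stepLaw, Measure.coe_finsetSum, Finset.sum_apply, Measure.smul_apply]
  conv_rhs => rw [← Equiv.sum_comp e]
  refine Finset.sum_congr rfl fun i _ => ?_
  rw [Measure.dirac_apply' _ (hm hs), Measure.dirac_apply' _ hs, ← hg]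
  rfl

variable [NeZero d]

/-- A reindexing of the steps along an injective map preserves the law. -/
lemma measurePreserving_reindex {σ : ℕ → ℕ} (hσ : Function.Injective σ) :
    MeasurePreserving (fun (x : ℕ → Lattice d) k => x (σ k)) (pathLaw d) (pathLaw d) := by
  refine ⟨measurable_pi_lambda _ fun _ => measurable_pi_apply _, ?_⟩
  unfold pathLaw
  exact Measure.map_infinitePi_infinitePi_of_inj (P := fun _ => stepLaw d) hσ

lemma measurePreserving_shift (m : ℕ) :
    MeasurePreserving (shift m) (pathLaw d) (pathLaw d) :=
  measurePreserving_reindex (add_right_injective m)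

/-- The Markov property at a fixed time. -/
theorem pathLaw_inter_shift {m : ℕ} {A B : Set (ℕ → Lattice d)} (hA : DeterminedBefore m A)
    (hB : MeasurableSet B) :
    pathLaw d (A ∩ shift m ⁻¹' B) = pathLaw d A * pathLaw d B := by
  have hind : iIndepFun (fun (k : ℕ) (x : ℕ → Lattice d) => x k) (pathLaw d) :=
    iIndepFun_infinitePi (P := fun _ : ℕ => stepLaw d) (X := fun _ v => v) (fun _ => measurable_id)
  have hdisj : Disjoint {k : ℕ | k < m} {k : ℕ | m ≤ k} := by
    rw [Set.disjoint_left]; intro k hk hk'; simp only [Set.mem_ofPred_eq] at hk hk'; omega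
  have h := indep_iSup_of_disjoint (fun k => (measurable_pi_apply k).comap_le) hind hdisj
  have hB' : MeasurableSet[⨆ k ∈ {k : ℕ | m ≤ k},
      MeasurableSpace.comap (fun x : ℕ → Lattice d => x k) inferInstance] (shift m ⁻¹' B) := by
    have hs : @Measurable _ _ (⨆ k ∈ {k : ℕ | m ≤ k},
        MeasurableSpace.comap (fun x : ℕ → Lattice d => x k) inferInstance) _ (shift m) := by
      refine @measurable_pi_lambda _ _ _ (_) _ _ fun k => ?_
      rw [measurable_iff_comap_le]
      exact le_iSup₂_of_le (m + k) (by simp) le_rfl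
    exact hs hB
  rw [(Indep_iff _ _ _).1 h _ _ hA.measurableSet_iSup hB',
    (measurePreserving_shift m).measure_preimage hB.nullMeasurableSet]

/-- The Markov property at the first of finitely or countably many disjoint times. -/
theorem pathLaw_iUnion_inter_shift {ι : Type*} [Countable ι] (τ : ι → ℕ)
    {H : ι → Set (ℕ → Lattice d)} (hH : ∀ s, DeterminedBefore (τ s) (H s))
    (hdisj : Pairwise (Function.onFun Disjoint H)) {B : Set (ℕ → Lattice d)}
    (hB : MeasurableSet B) :
    pathLaw d (⋃ s, (H s ∩ shift (τ s) ⁻¹' B)) = pathLaw d (⋃ s, H s) * pathLaw d B := by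
  rw [measure_iUnion, measure_iUnion hdisj fun s => (hH s).measurableSet, ← ENNReal.tsum_mul_right]
  · exact tsum_congr fun s => pathLaw_inter_shift (hH s) hB
  · exact fun s t hst => (hdisj hst).mono Set.inter_subset_left Set.inter_subset_left
  · exact fun s => (hH s).measurableSet.inter (measurable_shift _ hB)

/-- A map of the lattice that permutes the unit vectors preserves the law. -/
lemma measurePreserving_comp {g : Lattice d → Lattice d} (e : Fin d ⊕ Fin d ≃ Fin d ⊕ Fin d)
    (hg : ∀ i, g (unitVec i) = unitVec (e i)) :
    MeasurePreserving (fun (x : ℕ → Lattice d) k => g (x k)) (pathLaw d) (pathLaw d) := by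
  have hm : Measurable g := measurable_of_countable g
  refine ⟨measurable_pi_lambda _ fun k => hm.comp (measurable_pi_apply k), ?_⟩
  unfold pathLaw
  have h := Measure.infinitePi_map_pi (μ := fun _ : ℕ => stepLaw d) (f := fun _ => g)
    (fun _ => hm)
  rw [h]
  congr 1
  funext _
  exact stepLaw_map e hg

lemma pathLaw_first_step (i : Fin d ⊕ Fin d) :
    pathLaw d {x | x 0 = unitVec i} = (2 * (d : ℝ≥0∞))⁻¹ := by
  rw [← stepLaw_singleton_unitVec i]
  exact (measurePreserving_eval_infinitePi (fun _ : ℕ => stepLaw d) 0).measure_preimage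
    (measurableSet_singleton _).nullMeasurableSet

/-- Decomposition of an event along the first step. -/
lemma pathLaw_first_step_decomposition {A : Set (ℕ → Lattice d)}
    (B : Fin d ⊕ Fin d → Set (ℕ → Lattice d)) (hB : ∀ i, MeasurableSet (B i))
    (hAB : ∀ x i, x 0 = unitVec i → (x ∈ A ↔ shift 1 x ∈ B i)) :
    pathLaw d A = (2 * (d : ℝ≥0∞))⁻¹ * ∑ i, pathLaw d (B i) := by
  have hdet : ∀ i : Fin d ⊕ Fin d, DeterminedBefore 1 {x : ℕ → Lattice d | x 0 = unitVec i} := by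
    intro i x y hxy hx
    simp only [Set.mem_ofPred_eq] at hx ⊢
    rw [← hxy 0 one_pos, hx]
  have hdisj : Pairwise (Function.onFun Disjoint
      fun i : Fin d ⊕ Fin d => {x : ℕ → Lattice d | x 0 = unitVec i}) := by
    intro i j hij
    refine Set.disjoint_left.2 fun x hx hx' => hij (unitVec_injective ?_)
    simp only [Set.mem_ofPred_eq] at hx hx'
    rw [← hx, hx']
  have hU : pathLaw d (⋃ i, {x : ℕ → Lattice d | x 0 = unitVec i}) = 1 := by
    rw [measure_iUnion hdisj fun i => (hdet i).measurableSet, tsum_fintype]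
    simp only [pathLaw_first_step, Finset.sum_const, Finset.card_univ, Fintype.card_sum,
      Fintype.card_fin, nsmul_eq_mul]
    have hd : (d : ℝ≥0∞) ≠ 0 := by exact_mod_cast NeZero.ne d
    push_cast
    rw [← two_mul]
    exact ENNReal.mul_inv_cancel (by simp [hd]) (by finiteness)
  have hUm : MeasurableSet (⋃ i, {x : ℕ → Lattice d | x 0 = unitVec i}) :=
    MeasurableSet.iUnion fun i => (hdet i).measurableSet
  have h1 : pathLaw d A = pathLaw d (⋃ i, ({x | x 0 = unitVec i} ∩ shift 1 ⁻¹' B i)) := by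
    have : pathLaw d A = pathLaw d (A ∩ ⋃ i, {x : ℕ → Lattice d | x 0 = unitVec i}) := by
      rw [measure_inter_conull]
      exact (prob_compl_eq_zero_iff hUm).2 hU
    rw [this]
    congr 1
    ext x
    simp only [Set.mem_inter_iff, Set.mem_iUnion, Set.mem_ofPred_eq, Set.mem_preimage]
    constructor
    · rintro ⟨hx, i, hi⟩
      exact ⟨i, hi, (hAB x i hi).1 hx⟩
    · rintro ⟨i, hi, hx⟩
      exact ⟨(hAB x i hi).2 hx, i, hi⟩
  rw [h1, measure_iUnion, tsum_fintype, Finset.mul_sum]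
  · refine Finset.sum_congr rfl fun i _ => ?_
    rw [pathLaw_inter_shift (hdet i) (hB i), pathLaw_first_step]
  · exact fun i j hij => (hdisj hij).mono Set.inter_subset_left Set.inter_subset_left
  · exact fun i => (hdet i).measurableSet.inter (measurable_shift _ (hB i))

/-- The law of the steps of a simple walk. -/
theorem IsSimpleWalkSteps.map_eq_pathLaw {Ω : Type*} [MeasurableSpace Ω] {μ : Measure Ω}
    [IsProbabilityMeasure μ] {X : ℕ → Ω → Lattice d} (hX : IsSimpleWalkSteps μ X) :
    μ.map (fun ω k => X k ω) = pathLaw d := by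
  have hd : (d : ℝ) ≠ 0 := by exact_mod_cast NeZero.ne d
  have hstep : ∀ k, μ.map (X k) = stepLaw d := by
    intro k
    have : IsProbabilityMeasure (μ.map (X k)) :=
      Measure.isProbabilityMeasure_map (hX.measurable k).aemeasurable
    -- Only the masses of the unit vectors are given. They yield domination of `stepLaw`, and
    -- equality of total masses does the rest.
    refine (Measure.eq_of_le_of_measure_univ_eq ?_ (by simp)).symm
    refine Measure.le_iff.2 fun s hs => ?_
    have hunit : ∀ i, μ.map (X k) {unitVec i} = (2 * (d : ℝ≥0∞))⁻¹ := by
      intro i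
      have h := hX.law k i
      rw [Measure.map_apply (hX.measurable k) (measurableSet_singleton _)]
      change μ {ω | X k ω = unitVec i} = _
      rw [← ENNReal.ofReal_toReal (measure_ne_top μ _)]
      rw [measureReal_def] at h
      rw [h, one_div, ENNReal.ofReal_inv_of_pos (by positivity), ENNReal.ofReal_mul (by norm_num)]
      simp
    classical
    have hsum : stepLaw d s = ∑ i ∈ Finset.univ.filter (fun i => unitVec i ∈ s),
        μ.map (X k) {unitVec i} := by
      simp only [stepLaw, Measure.coe_finsetSum, Finset.sum_apply, Measure.smul_apply,
        smul_eq_mul, hunit]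
      rw [Finset.sum_filter]
      refine Finset.sum_congr rfl fun i _ => ?_
      rw [Measure.dirac_apply' _ hs]
      by_cases hi : unitVec i ∈ s <;> simp [hi]
    rw [hsum, ← measure_biUnion_finset]
    · refine measure_mono ?_
      intro v hv
      simp only [Set.mem_iUnion, Finset.mem_filter, Finset.mem_univ, true_and,
        Set.mem_singleton_iff, exists_prop] at hv
      obtain ⟨i, hi, rfl⟩ := hv
      exact hi
    · intro i _ j _ hij
      simpa using fun h => hij (unitVec_injective h)
    · exact fun i _ => measurableSet_singleton _
  rw [hX.indep.map_fun_eq_infinitePi_map hX.measurable]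
  unfold pathLaw
  congr 1
  funext k
  exact hstep k

end Law

/-! ### Fourier inversion and the heat kernel bound -/

section HeatKernel

variable {d : ℕ}

/-- The characteristic function of a step. -/
def stepChar (θ : Fin d → ℝ) : ℝ := (d : ℝ)⁻¹ * ∑ j, Real.cos (θ j)

/-- Lebesgue measure on the cube `(-π, π]^d`. -/
def cubeMeasure (d : ℕ) : Measure (Fin d → ℝ) :=
  Measure.pi fun _ => volume.restrict (Set.Ioc (-Real.pi) Real.pi)

instance cubeMeasure_isFinite : IsFiniteMeasure (cubeMeasure d) := by
  unfold cubeMeasure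
  infer_instance

/-- The pairing of a lattice point with a frequency. -/
def pairing (v : Lattice d) (θ : Fin d → ℝ) : ℝ := ∑ j, (v j : ℝ) * θ j

lemma pairing_sub (v w : Lattice d) (θ : Fin d → ℝ) :
    pairing (v - w) θ = pairing v θ - pairing w θ := by
  simp [pairing, sub_mul, Finset.sum_sub_distrib]

lemma pairing_unitVec_inl (j : Fin d) (θ : Fin d → ℝ) :
    pairing (unitVec (Sum.inl j)) θ = θ j := by
  classical
  simp [pairing, unitVec, Pi.single_apply]

lemma pairing_unitVec_inr (j : Fin d) (θ : Fin d → ℝ) :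
    pairing (unitVec (Sum.inr j)) θ = -θ j := by
  classical
  simp [pairing, unitVec, Pi.single_apply]

@[fun_prop]
lemma continuous_pairing (v : Lattice d) : Continuous (pairing v) := by
  unfold pairing; fun_prop

@[fun_prop]
lemma continuous_stepChar : Continuous (stepChar : (Fin d → ℝ) → ℝ) := by
  unfold stepChar; fun_prop

lemma abs_stepChar_le_mean (θ : Fin d → ℝ) :
    |stepChar θ| ≤ (d : ℝ)⁻¹ * ∑ j, |Real.cos (θ j)| := by
  unfold stepChar
  rw [abs_mul, abs_of_nonneg (by positivity)]
  gcongr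
  exact Finset.abs_sum_le_sum_abs _ _

lemma abs_stepChar_le_one (θ : Fin d → ℝ) : |stepChar θ| ≤ 1 := by
  refine (abs_stepChar_le_mean θ).trans ?_
  have : ∑ j, |Real.cos (θ j)| ≤ d := by
    refine (Finset.sum_le_card_nsmul _ _ 1 fun j _ => Real.abs_cos_le_one _).trans ?_
    simp
  calc (d : ℝ)⁻¹ * ∑ j, |Real.cos (θ j)| ≤ (d : ℝ)⁻¹ * d := by gcongr
    _ ≤ 1 := inv_mul_le_one

lemma integrable_stepChar_pow_mul_cos (s : ℕ) (v : Lattice d) :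
    Integrable (fun θ => stepChar θ ^ s * Real.cos (pairing v θ)) (cubeMeasure d) := by
  refine Integrable.of_bound (C := 1) ?_ ?_
  · exact (by fun_prop : Continuous _).aestronglyMeasurable
  · refine Filter.Eventually.of_forall fun θ => ?_
    rw [Real.norm_eq_abs, abs_mul, abs_pow]
    exact mul_le_one₀ (pow_le_one₀ (abs_nonneg _) (abs_stepChar_le_one θ)) (abs_nonneg _)
      (Real.abs_cos_le_one _)

lemma integral_exp_int_mul_I (n : ℤ) :
    ∫ t in Set.Ioc (-Real.pi) Real.pi, Complex.exp ((n : ℂ) * Complex.I * t) =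
      if n = 0 then 2 * (Real.pi : ℂ) else 0 := by
  rw [← intervalIntegral.integral_of_le (by linarith [Real.pi_pos])]
  split_ifs with h
  · subst h
    simp
    ring
  · have hc : (n : ℂ) * Complex.I ≠ 0 := mul_ne_zero (by exact_mod_cast h) Complex.I_ne_zero
    rw [integral_exp_mul_complex hc, div_eq_zero_iff]
    left
    rw [sub_eq_zero, Complex.exp_eq_exp_iff_exists_int]
    exact ⟨n, by push_cast; ring⟩

/-- The cosine is the real part of a product of one-variable characters, so the integral factorises
and orthogonality of characters applies coordinatewise. -/
lemma integral_cos_pairing (v : Lattice d) :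
    ∫ θ, Real.cos (pairing v θ) ∂(cubeMeasure d) =
      if v = 0 then (2 * Real.pi) ^ d else 0 := by
  have h1 : ∀ θ : Fin d → ℝ, Real.cos (pairing v θ) =
      Complex.re (∏ j, Complex.exp ((v j : ℂ) * Complex.I * θ j)) := by
    intro θ
    rw [← Complex.exp_sum, ← Complex.exp_ofReal_mul_I_re]
    congr 2
    simp only [pairing]
    push_cast
    rw [Finset.sum_mul]
    exact Finset.sum_congr rfl fun j _ => by ring
  have h2 : Integrable (fun θ : Fin d → ℝ => ∏ j, Complex.exp ((v j : ℂ) * Complex.I * θ j))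
      (cubeMeasure d) := by
    refine Integrable.of_bound (C := 1) ?_ ?_
    · exact (by fun_prop : Continuous _).aestronglyMeasurable
    · refine Filter.Eventually.of_forall fun θ => ?_
      rw [norm_prod]
      refine Finset.prod_le_one (fun _ _ => norm_nonneg _) fun j _ => ?_
      rw [Complex.norm_exp]
      simp
  simp_rw [h1]
  have h3 := integral_re h2
  simp only [RCLike.re_eq_complex_re] at h3
  rw [h3]
  unfold cubeMeasure
  rw [integral_fintype_prod_eq_prod (fun j (t : ℝ) => Complex.exp ((v j : ℂ) * Complex.I * t))]
  simp_rw [integral_exp_int_mul_I]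
  split_ifs with h
  · subst h
    simp only [Pi.zero_apply, if_true, Finset.prod_const, Finset.card_univ, Fintype.card_fin]
    have : (2 * (Real.pi : ℂ)) ^ d = (((2 * Real.pi) ^ d : ℝ) : ℂ) := by push_cast; ring
    rw [this, Complex.ofReal_re]
  · obtain ⟨j, hj⟩ := Function.ne_iff.1 h
    rw [Finset.prod_eq_zero (Finset.mem_univ j)]
    · simp
    · simpa using hj

lemma determinedBefore_pos_eq {m s : ℕ} (h : s ≤ m) (v : Lattice d) :
    DeterminedBefore m {x | pos x s = v} := by
  intro x y hxy hx
  simp only [Set.mem_ofPred_eq] at hx ⊢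
  rw [← pos_congr hxy h, hx]

/-- The sines cancel between opposite unit vectors. Hence one step of the walk multiplies by
`stepChar`, and Fourier inversion can stay real. -/
lemma mean_cos_sub_unitVec (v : Lattice d) (θ : Fin d → ℝ) :
    (2 * (d : ℝ))⁻¹ * ∑ i, Real.cos (pairing (v - unitVec i) θ) =
      stepChar θ * Real.cos (pairing v θ) := by
  rw [Fintype.sum_sum_type, ← Finset.sum_add_distrib, stepChar, mul_inv, mul_assoc, mul_assoc,
    Finset.sum_mul, mul_left_comm, Finset.mul_sum]
  congr 1
  refine Finset.sum_congr rfl fun j _ => ?_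
  rw [pairing_sub, pairing_sub, pairing_unitVec_inl, pairing_unitVec_inr, sub_neg_eq_add,
    Real.cos_sub, Real.cos_add]
  ring

variable [NeZero d]

lemma pathLaw_pos_succ (s : ℕ) (v : Lattice d) :
    (pathLaw d).real {x | pos x (s + 1) = v} =
      (2 * (d : ℝ))⁻¹ * ∑ i, (pathLaw d).real {x | pos x s = v - unitVec i} := by
  have h := pathLaw_first_step_decomposition (A := {x : ℕ → Lattice d | pos x (s + 1) = v})
    (fun i => {x | pos x s = v - unitVec i})
    (fun i => (determinedBefore_pos_eq le_rfl _).measurableSet)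
    (by
      intro x i hx
      simp only [Set.mem_ofPred_eq]
      rw [add_comm s 1, pos_add, pos_succ, pos_zero, zero_add, hx, eq_sub_iff_add_eq, add_comm])
  simp only [measureReal_def]
  rw [h, ENNReal.toReal_mul, ENNReal.toReal_sum (fun _ _ => measure_ne_top _ _)]
  simp

/-- The Fourier inversion formula for the distribution of the walk. -/
theorem pathLaw_pos_eq_integral (s : ℕ) (v : Lattice d) :
    (2 * Real.pi) ^ d * (pathLaw d).real {x | pos x s = v} =
      ∫ θ, stepChar θ ^ s * Real.cos (pairing v θ) ∂(cubeMeasure d) := by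
  induction s generalizing v with
  | zero =>
    simp only [pos_zero, pow_zero, one_mul, integral_cos_pairing]
    split_ifs with h
    · subst h; simp
    · simp [Ne.symm h]
  | succ s ih =>
    rw [pathLaw_pos_succ, mul_left_comm, Finset.mul_sum]
    simp_rw [ih]
    rw [← integral_finsetSum _ fun i _ => integrable_stepChar_pow_mul_cos s _,
      ← integral_const_mul]
    refine integral_congr_ae (Filter.Eventually.of_forall fun θ => ?_)
    simp only
    rw [← Finset.mul_sum, mul_left_comm, mean_cos_sub_unitVec, pow_succ]
    ring

/-- If `c` is the nearest of `0`, `π`, `-π`, then `1 - |cos t| ≥ sin² t / 2 ≥ (2 / π²) (t - c)²` by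
Jordan's inequality. The centres `±π` are needed because the walk has period two: `|stepChar|` also
equals one at the corner frequencies. -/
lemma exp_abs_cos_le {a t : ℝ} (ha : 0 ≤ a) (ht : t ∈ Set.Ioc (-Real.pi) Real.pi) :
    Real.exp (-a * (1 - |Real.cos t|)) ≤
      Real.exp (-(2 * a / Real.pi ^ 2) * t ^ 2) +
        Real.exp (-(2 * a / Real.pi ^ 2) * (t - Real.pi) ^ 2) +
        Real.exp (-(2 * a / Real.pi ^ 2) * (t + Real.pi) ^ 2) := by
  have key : ∀ c : ℝ, |t - c| ≤ Real.pi / 2 → |Real.sin (t - c)| = |Real.sin t| →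
      Real.exp (-a * (1 - |Real.cos t|)) ≤ Real.exp (-(2 * a / Real.pi ^ 2) * (t - c) ^ 2) := by
    intro c hc hs
    rw [Real.exp_le_exp]
    have h1 := Real.mul_abs_le_abs_sin hc
    rw [hs] at h1
    have h2 : (2 / Real.pi * |t - c|) ^ 2 ≤ |Real.sin t| ^ 2 := by gcongr
    rw [mul_pow, sq_abs, sq_abs, Real.sin_sq, ← sq_abs (Real.cos t), div_pow] at h2
    have h3 := Real.abs_cos_le_one t
    have h4 := abs_nonneg (Real.cos t)
    have h5 : 2 / Real.pi ^ 2 * (t - c) ^ 2 ≤ 1 - |Real.cos t| := by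
      have e : (2 : ℝ) ^ 2 / Real.pi ^ 2 * (t - c) ^ 2 =
        2 * (2 / Real.pi ^ 2 * (t - c) ^ 2) := by ring
      rw [e] at h2
      nlinarith
    have h6 := mul_le_mul_of_nonneg_left h5 ha
    have e : -(2 * a / Real.pi ^ 2) * (t - c) ^ 2 = -(a * (2 / Real.pi ^ 2 * (t - c) ^ 2)) := by
      ring
    rw [e]
    linarith
  have hp0 := Real.exp_nonneg (-(2 * a / Real.pi ^ 2) * t ^ 2)
  have hp1 := Real.exp_nonneg (-(2 * a / Real.pi ^ 2) * (t - Real.pi) ^ 2)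
  have hp2 := Real.exp_nonneg (-(2 * a / Real.pi ^ 2) * (t + Real.pi) ^ 2)
  by_cases h1 : Real.pi / 2 < t
  · have := key Real.pi (abs_le.2 ⟨by linarith, by linarith [ht.2, Real.pi_pos]⟩)
      (by rw [Real.sin_sub_pi, abs_neg])
    linarith
  · by_cases h2 : t < -(Real.pi / 2)
    · have := key (-Real.pi)
        (abs_le.2 ⟨by linarith [ht.1, Real.pi_pos], by linarith⟩)
        (by rw [sub_neg_eq_add, Real.sin_add_pi, abs_neg])
      rw [sub_neg_eq_add] at this
      linarith
    · have := key 0 (abs_le.2 ⟨by linarith, by linarith⟩) (by rw [sub_zero])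
      rw [sub_zero] at this
      linarith

lemma integral_exp_abs_cos_le {a : ℝ} (ha : 0 < a) :
    ∫ t in Set.Ioc (-Real.pi) Real.pi, Real.exp (-a * (1 - |Real.cos t|)) ≤
      3 * Real.sqrt (Real.pi / (2 * a / Real.pi ^ 2)) := by
  set b := 2 * a / Real.pi ^ 2 with hb
  have hb0 : 0 < b := by have := Real.pi_pos; positivity
  have hg : Integrable fun t : ℝ => Real.exp (-b * t ^ 2) := integrable_exp_neg_mul_sq hb0
  have hgs : ∀ c : ℝ, Integrable fun t : ℝ => Real.exp (-b * (t + c) ^ 2) :=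
    fun c => hg.comp_add_right c
  have hgi : ∀ c : ℝ, ∫ t : ℝ, Real.exp (-b * (t + c) ^ 2) = Real.sqrt (Real.pi / b) := by
    intro c
    rw [integral_add_right_eq_self (fun t : ℝ => Real.exp (-b * t ^ 2)) c, integral_gaussian]
  have hsum : Integrable fun t : ℝ => Real.exp (-b * (t + 0) ^ 2) +
      Real.exp (-b * (t + -Real.pi) ^ 2) + Real.exp (-b * (t + Real.pi) ^ 2) :=
    ((hgs 0).add (hgs _)).add (hgs _)
  calc ∫ t in Set.Ioc (-Real.pi) Real.pi, Real.exp (-a * (1 - |Real.cos t|))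
      ≤ ∫ t in Set.Ioc (-Real.pi) Real.pi, (Real.exp (-b * (t + 0) ^ 2) +
          Real.exp (-b * (t + -Real.pi) ^ 2) + Real.exp (-b * (t + Real.pi) ^ 2)) := by
        refine setIntegral_mono_on ?_ hsum.integrableOn measurableSet_Ioc fun t ht => ?_
        · refine (Continuous.integrableOn_Icc ?_).mono_set Set.Ioc_subset_Icc_self
          fun_prop
        · have := exp_abs_cos_le ha.le ht
          rwa [add_zero, ← sub_eq_add_neg]
    _ ≤ ∫ t : ℝ, (Real.exp (-b * (t + 0) ^ 2) +
          Real.exp (-b * (t + -Real.pi) ^ 2) + Real.exp (-b * (t + Real.pi) ^ 2)) :=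
        setIntegral_le_integral hsum (Filter.Eventually.of_forall fun t => by positivity)
    _ = 3 * Real.sqrt (Real.pi / b) := by
        have h01 : Integrable fun t : ℝ => Real.exp (-b * (t + 0) ^ 2) +
          Real.exp (-b * (t + -Real.pi) ^ 2) := (hgs 0).add (hgs _)
        rw [integral_add h01 (hgs _), integral_add (hgs 0) (hgs _), hgi, hgi, hgi]
        ring

/-- The inequality `y ≤ exp (y - 1)` turns a power of an average into a product over coordinates,
whose integral over the cube factorises. -/
lemma abs_stepChar_pow_le (s : ℕ) (θ : Fin d → ℝ) :
    |stepChar θ| ^ s ≤ ∏ j, Real.exp (-((s : ℝ) / d) * (1 - |Real.cos (θ j)|)) := by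
  have hd : (d : ℝ) ≠ 0 := by exact_mod_cast NeZero.ne d
  rw [← Real.exp_sum, ← Finset.mul_sum, Finset.sum_sub_distrib]
  have h1 : |stepChar θ| ≤ Real.exp ((d : ℝ)⁻¹ * ∑ j, |Real.cos (θ j)| - 1) := by
    refine (abs_stepChar_le_mean θ).trans ?_
    have := Real.add_one_le_exp ((d : ℝ)⁻¹ * ∑ j, |Real.cos (θ j)| - 1)
    linarith
  calc |stepChar θ| ^ s ≤ Real.exp ((d : ℝ)⁻¹ * ∑ j, |Real.cos (θ j)| - 1) ^ s := by gcongr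
    _ = Real.exp (s * ((d : ℝ)⁻¹ * ∑ j, |Real.cos (θ j)| - 1)) := by rw [Real.exp_nat_mul]
    _ = _ := by
      congr 1
      simp only [Finset.sum_const, Finset.card_univ, Fintype.card_fin, nsmul_eq_mul, mul_one]
      field_simp
      ring

/-- The uniform heat kernel bound, in the form valid in dimension at least four. -/
theorem exists_pathLaw_pos_le (hd : 4 ≤ d) :
    ∃ C : ℝ, 0 < C ∧ ∀ s : ℕ, 1 ≤ s → ∀ v : Lattice d,
      (pathLaw d).real {x | pos x s = v} ≤ C / (s : ℝ) ^ 2 := by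
  have hpi := Real.pi_pos
  have hd0 : (0 : ℝ) < d := by exact_mod_cast (by omega : 0 < d)
  set c : ℝ := 3 * Real.sqrt (Real.pi ^ 3 * d / 2) with hc
  have hc0 : 0 < c := by positivity
  refine ⟨(c / (2 * Real.pi)) ^ d, by positivity, fun s hs v => ?_⟩
  have hs0 : (0 : ℝ) < s := by exact_mod_cast hs
  have hs1 : (1 : ℝ) ≤ s := by exact_mod_cast hs
  have h1 : (2 * Real.pi) ^ d * (pathLaw d).real {x | pos x s = v} ≤ (c / Real.sqrt s) ^ d := by
    rw [pathLaw_pos_eq_integral]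
    calc ∫ θ, stepChar θ ^ s * Real.cos (pairing v θ) ∂(cubeMeasure d)
        ≤ ∫ θ, ∏ j, Real.exp (-((s : ℝ) / d) * (1 - |Real.cos (θ j)|)) ∂(cubeMeasure d) := by
          refine integral_mono (integrable_stepChar_pow_mul_cos s v) ?_ fun θ => ?_
          · refine Integrable.of_bound (C := 1) ?_ ?_
            · exact (by fun_prop : Continuous _).aestronglyMeasurable
            · refine Filter.Eventually.of_forall fun θ => ?_
              rw [norm_prod]
              refine Finset.prod_le_one (fun _ _ => norm_nonneg _) fun j _ => ?_
              rw [Real.norm_eq_abs, Real.abs_exp, Real.exp_le_one_iff]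
              have := Real.abs_cos_le_one (θ j)
              have h2 : 0 ≤ (s : ℝ) / d * (1 - |Real.cos (θ j)|) :=
                mul_nonneg (by positivity) (by linarith)
              linarith
          · refine le_trans (le_abs_self _) ?_
            rw [abs_mul, abs_pow]
            refine (mul_le_of_le_one_right (by positivity) (Real.abs_cos_le_one _)).trans ?_
            exact abs_stepChar_pow_le s θ
      _ = (∫ t in Set.Ioc (-Real.pi) Real.pi,
            Real.exp (-((s : ℝ) / d) * (1 - |Real.cos t|))) ^ d := by
          unfold cubeMeasure
          rw [integral_fintype_prod_eq_prod
            (fun (_ : Fin d) (t : ℝ) => Real.exp (-((s : ℝ) / d) * (1 - |Real.cos t|)))]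
          simp
      _ ≤ (c / Real.sqrt s) ^ d := by
          refine pow_le_pow_left₀ (integral_nonneg fun t => Real.exp_nonneg _) ?_ d
          refine (integral_exp_abs_cos_le (by positivity)).trans (le_of_eq ?_)
          rw [hc, mul_div_assoc (3 : ℝ), ← Real.sqrt_div' (Real.pi ^ 3 * d / 2) hs0.le]
          congr 2
          field_simp
  -- The natural bound is of order `s ^ (-d / 2)`; this is where dimension at least four enters.
  have h2 : (1 / Real.sqrt s) ^ d ≤ 1 / (s : ℝ) ^ 2 := by
    have hsq : 1 ≤ Real.sqrt s := Real.one_le_sqrt.2 hs1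
    have h3 : (1 / Real.sqrt s) ^ d ≤ (1 / Real.sqrt s) ^ 4 :=
      pow_le_pow_of_le_one (by positivity) (by rw [div_le_one (by positivity)]; exact hsq) hd
    refine h3.trans (le_of_eq ?_)
    rw [div_pow, one_pow]
    congr 1
    rw [show (4 : ℕ) = 2 * 2 by norm_num, pow_mul, Real.sq_sqrt hs0.le]
  have h4 : (c / Real.sqrt s) ^ d = c ^ d * (1 / Real.sqrt s) ^ d := by
    rw [← mul_pow]; congr 1; ring
  rw [h4] at h1
  have h5 := h1.trans (mul_le_mul_of_nonneg_left h2 (by positivity : 0 ≤ c ^ d))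
  rw [div_pow, div_div, le_div_iff₀ (by positivity)]
  calc (pathLaw d).real {x | pos x s = v} * ((2 * Real.pi) ^ d * (s : ℝ) ^ 2)
      = (2 * Real.pi) ^ d * (pathLaw d).real {x | pos x s = v} * (s : ℝ) ^ 2 := by ring
    _ ≤ c ^ d * (1 / (s : ℝ) ^ 2) * (s : ℝ) ^ 2 := by gcongr
    _ = c ^ d := by field_simp

end HeatKernel

/-! ### Transience and hitting probabilities -/

section Transience

variable {d : ℕ} [NeZero d]

/-- The probability of a late visit to a point decays polynomially, uniformly in the point. -/
theorem exists_pathLaw_late_visit_le (hd : 4 ≤ d) :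
    ∃ C : ℝ, 0 < C ∧ ∀ T : ℕ, 1 ≤ T → ∀ v : Lattice d,
      pathLaw d {x | ∃ s, T ≤ s ∧ pos x s = v} ≤ ENNReal.ofReal (C / T) := by
  obtain ⟨C, hC, h⟩ := exists_pathLaw_pos_le hd
  refine ⟨2 * C, by positivity, fun T hT v => ?_⟩
  have hT0 : (1 : ℝ) ≤ T := by exact_mod_cast hT
  have hsub : {x : ℕ → Lattice d | ∃ s, T ≤ s ∧ pos x s = v} ⊆
      ⋃ k : ℕ, {x | pos x (T + k) = v} := by
    rintro x ⟨s, hs, hx⟩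
    obtain ⟨k, rfl⟩ := Nat.exists_eq_add_of_le hs
    exact Set.mem_iUnion.2 ⟨k, hx⟩
  refine (measure_mono hsub).trans ((measure_iUnion_le _).trans ?_)
  have hk : ∀ k : ℕ, pathLaw d {x : ℕ → Lattice d | pos x (T + k) = v} ≤
      ENNReal.ofReal (C / ((T : ℝ) + k) ^ 2) := by
    intro k
    have := h (T + k) (by omega) v
    rw [← ENNReal.ofReal_toReal (measure_ne_top (pathLaw d) _)]
    refine ENNReal.ofReal_le_ofReal ?_
    rw [measureReal_def] at this
    push_cast at this
    exact this
  refine (ENNReal.tsum_le_tsum hk).trans (ENNReal.tsum_le_of_sum_range_le fun n => ?_)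
  rw [← ENNReal.ofReal_sum_of_nonneg fun _ _ => by positivity]
  refine ENNReal.ofReal_le_ofReal ?_
  -- Telescoping: for `a ≥ 1` one has `1 / a² ≤ 2 / a - 2 / (a + 1)`.
  have hind : ∑ k ∈ Finset.range n, C / ((T : ℝ) + k) ^ 2 ≤
      2 * C / T - 2 * C / ((T : ℝ) + n) := by
    induction n with
    | zero => simp
    | succ n ih =>
      rw [Finset.sum_range_succ]
      have hn : (0 : ℝ) ≤ n := Nat.cast_nonneg n
      have : C / ((T : ℝ) + n) ^ 2 ≤ 2 * C / ((T : ℝ) + n) - 2 * C / ((T : ℝ) + (n + 1 : ℕ)) := by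
        push_cast
        have h1 : 0 < (T : ℝ) + n := by linarith
        have h2 : 2 * C / ((T : ℝ) + n) - 2 * C / ((T : ℝ) + (n + 1)) =
            2 * C / (((T : ℝ) + n) * ((T : ℝ) + (n + 1))) := by
          have : (T : ℝ) + (n + 1) ≠ 0 := by linarith
          field_simp
          ring
        rw [h2, div_le_div_iff₀ (by positivity) (by positivity)]
        nlinarith [mul_pos hC h1]
      linarith
  have : 0 ≤ 2 * C / ((T : ℝ) + n) := by positivity
  linarith

omit [NeZero d] in
lemma measurableSet_pos_eq (s : ℕ) (v : Lattice d) : MeasurableSet {x | pos x s = v} :=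
  (determinedBefore_pos_eq le_rfl v).measurableSet

/-- The event that the walk visits `v` at some positive time. -/
def hitEvent (v : Lattice d) : Set (ℕ → Lattice d) := {x | ∃ n, 1 ≤ n ∧ pos x n = v}

omit [NeZero d] in
lemma measurableSet_hitEvent (v : Lattice d) : MeasurableSet (hitEvent v) := by
  have : hitEvent v = ⋃ n : ℕ, ⋃ _ : 1 ≤ n, {x | pos x n = v} := by
    ext x; simp [hitEvent]
  rw [this]
  exact MeasurableSet.iUnion fun n => MeasurableSet.iUnion fun _ => measurableSet_pos_eq n v

/-- If return were certain, then almost surely no visit to the origin would be the last one, so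
visits would occur after every time `T`; for large `T` this contradicts the decay of late visits. -/
theorem pathLaw_hitEvent_zero_lt_one (hd : 4 ≤ d) :
    pathLaw d (hitEvent (0 : Lattice d)) < 1 := by
  obtain ⟨C, hC, h⟩ := exists_pathLaw_late_visit_le hd
  obtain ⟨T, hT⟩ := exists_nat_gt (max C 1)
  have hT1 : 1 ≤ T := by
    have : (1 : ℝ) < T := (le_max_right _ _).trans_lt hT
    exact_mod_cast this.le
  have hlate := h T hT1 0
  by_contra hcon
  have hone : pathLaw d (hitEvent (0 : Lattice d)) = 1 := le_antisymm prob_le_one (not_lt.1 hcon)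
  have hzero : pathLaw d (hitEvent (0 : Lattice d))ᶜ = 0 :=
    (prob_compl_eq_zero_iff (measurableSet_hitEvent 0)).2 hone
  have hsub : ({x : ℕ → Lattice d | ∃ s, T ≤ s ∧ pos x s = 0})ᶜ ⊆
      ⋃ s : ℕ, ({x | pos x s = 0} ∩ shift s ⁻¹' (hitEvent (0 : Lattice d))ᶜ) := by
    intro x hx
    have hx' : ∀ s, T ≤ s → pos x s ≠ 0 := fun s hs h0 => hx ⟨s, hs, h0⟩
    classical
    -- The last visit to the origin; it exists because the walk is there at time `0`.
    set s := Nat.findGreatest (fun s => pos x s = 0) T with hs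
    have hs0 : pos x s = 0 := Nat.findGreatest_spec (P := fun s => pos x s = 0) (Nat.zero_le T)
      (pos_zero x)
    refine Set.mem_iUnion.2 ⟨s, hs0, ?_⟩
    rintro ⟨n, hn, hxn⟩
    have h1 : pos x (s + n) = 0 := by rw [pos_add, hs0, hxn, add_zero]
    by_cases hle : s + n ≤ T
    · exact Nat.findGreatest_is_greatest (P := fun s => pos x s = 0) (n := T) (k := s + n)
        (by omega) hle h1
    · exact hx' _ (by omega) h1
  have hnull : pathLaw d ({x : ℕ → Lattice d | ∃ s, T ≤ s ∧ pos x s = 0})ᶜ = 0 := by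
    refine measure_mono_null hsub (measure_iUnion_null fun s => ?_)
    rw [pathLaw_inter_shift (determinedBefore_pos_eq le_rfl 0) (measurableSet_hitEvent 0).compl,
      hzero, mul_zero]
  have hmeas : MeasurableSet {x : ℕ → Lattice d | ∃ s, T ≤ s ∧ pos x s = 0} := by
    have : {x : ℕ → Lattice d | ∃ s, T ≤ s ∧ pos x s = 0} =
        ⋃ s : ℕ, ⋃ _ : T ≤ s, {x | pos x s = 0} := by
      ext x; simp
    rw [this]
    exact MeasurableSet.iUnion fun n => MeasurableSet.iUnion fun _ => measurableSet_pos_eq n _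
  rw [(prob_compl_eq_zero_iff hmeas).1 hnull] at hlate
  rw [ENNReal.one_le_ofReal, one_le_div (by linarith [le_max_left C 1])] at hlate
  linarith [le_max_left C 1]

theorem pathLaw_hitEvent_zero_pos : 0 < pathLaw d (hitEvent (0 : Lattice d)) := by
  have i : Fin d ⊕ Fin d := Sum.inl 0
  have hsub : {x : ℕ → Lattice d | x 0 = unitVec i} ∩ shift 1 ⁻¹' {x | x 0 = unitVec i.swap} ⊆
      hitEvent (0 : Lattice d) := by
    rintro x ⟨h1, h2⟩
    refine ⟨2, by norm_num, ?_⟩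
    have h2' : x 1 = unitVec i.swap := h2
    have h1' : x 0 = unitVec i := h1
    rw [pos_succ, pos_succ, pos_zero, zero_add, h1', h2', unitVec_swap, add_neg_cancel]
  have hdet : ∀ i : Fin d ⊕ Fin d, DeterminedBefore 1 {x : ℕ → Lattice d | x 0 = unitVec i} := by
    intro i x y hxy hx
    simp only [Set.mem_ofPred_eq] at hx ⊢
    rw [← hxy 0 one_pos, hx]
  refine lt_of_lt_of_le ?_ (measure_mono hsub)
  rw [pathLaw_inter_shift (hdet i) (hdet _).measurableSet, pathLaw_first_step, pathLaw_first_step]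
  refine ENNReal.mul_pos ?_ ?_ <;> exact ENNReal.inv_ne_zero.2 (by finiteness)

lemma pathLaw_hitEvent_map {g : Lattice d →+ Lattice d} (hg : Function.Injective g)
    (e : Fin d ⊕ Fin d ≃ Fin d ⊕ Fin d) (hge : ∀ i, g (unitVec i) = unitVec (e i))
    (v : Lattice d) : pathLaw d (hitEvent (g v)) = pathLaw d (hitEvent v) := by
  rw [← (measurePreserving_comp e hge).measure_preimage (measurableSet_hitEvent _).nullMeasurableSet]
  congr 1
  ext x
  have : ∀ n, pos (fun k => g (x k)) n = g (pos x n) := fun n => by simp [pos]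
  simp [hitEvent, this, hg.eq_iff]

/-- Negation and transpositions of coordinates preserve the law and act transitively on the unit
vectors. -/
lemma pathLaw_hitEvent_unitVec (i j : Fin d ⊕ Fin d) :
    pathLaw d (hitEvent (unitVec i)) = pathLaw d (hitEvent (unitVec j)) := by
  have hneg : ∀ i : Fin d ⊕ Fin d,
      pathLaw d (hitEvent (unitVec i.swap)) = pathLaw d (hitEvent (unitVec i)) := by
    intro i
    rw [unitVec_swap]
    exact pathLaw_hitEvent_map (g := negAddMonoidHom) neg_injective (Equiv.sumComm _ _)
      (fun i => (unitVec_swap i).symm) _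
  have hinl : ∀ a b : Fin d, pathLaw d (hitEvent (unitVec (Sum.inl a))) =
      pathLaw d (hitEvent (unitVec (Sum.inl b))) := by
    intro a b
    let g : Lattice d →+ Lattice d :=
      { toFun := fun v => v ∘ Equiv.swap a b
        map_zero' := rfl
        map_add' := fun _ _ => rfl }
    have hsingle : ∀ c : Fin d, (Pi.single c (1 : ℤ) : Lattice d) ∘ Equiv.swap a b =
        Pi.single (Equiv.swap a b c) 1 := by
      intro c
      funext k
      simp only [Function.comp_apply, Pi.single_apply]
      congr 1
      rw [eq_iff_iff, Equiv.swap_apply_eq_iff]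
    have hge : ∀ i : Fin d ⊕ Fin d, g (unitVec i) =
        unitVec (Equiv.sumCongr (Equiv.swap a b) (Equiv.swap a b) i) := by
      rintro (c | c)
      · exact hsingle c
      · change -((Pi.single c (1 : ℤ) : Lattice d) ∘ Equiv.swap a b) = _
        rw [hsingle c]; rfl
    have hginj : Function.Injective g := by
      intro v w hvw
      funext k
      have := congrFun hvw (Equiv.swap a b k)
      simpa [g] using this
    have h := pathLaw_hitEvent_map hginj _ hge (unitVec (Sum.inl a))
    rw [hge] at h
    simpa using h.symm
  have hall : ∀ i : Fin d ⊕ Fin d, pathLaw d (hitEvent (unitVec i)) =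
      pathLaw d (hitEvent (unitVec (Sum.inl 0))) := by
    rintro (a | a)
    · exact hinl _ _
    · rw [← hneg]; exact hinl _ _
  rw [hall i, hall j]

/-- The walk is as likely to return to the origin as to hit a given neighbour of it. -/
lemma pathLaw_hitEvent_unitVec_eq (i : Fin d ⊕ Fin d) :
    pathLaw d (hitEvent (unitVec i)) = pathLaw d (hitEvent 0) := by
  -- After a first step `e`, returning to the origin means that the remaining walk hits `-e`. The
  -- return probability is thus an average of equal terms.
  have h := pathLaw_first_step_decomposition (A := hitEvent (0 : Lattice d))
    (fun i => hitEvent (unitVec i.swap)) (fun i => measurableSet_hitEvent _)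
    (by
      intro x i hx
      constructor
      · rintro ⟨n, hn, hxn⟩
        obtain ⟨m, rfl⟩ := Nat.exists_eq_add_of_le hn
        rw [pos_add, pos_succ, pos_zero, zero_add, hx] at hxn
        refine ⟨m, ?_, ?_⟩
        · rcases m with _ | m
          · rw [pos_zero, add_zero] at hxn
            exact absurd hxn (unitVec_ne_zero i)
          · omega
        · rw [unitVec_swap]; exact (neg_eq_of_add_eq_zero_right hxn).symm
      · rintro ⟨n, hn, hxn⟩
        refine ⟨1 + n, by omega, ?_⟩
        rw [pos_add, pos_succ, pos_zero, zero_add, hx, hxn, unitVec_swap, add_neg_cancel])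
  rw [h, Finset.sum_congr rfl fun j _ => pathLaw_hitEvent_unitVec j.swap i]
  have hd : (d : ℝ≥0∞) ≠ 0 := by exact_mod_cast NeZero.ne d
  simp only [Finset.sum_const, Finset.card_univ, Fintype.card_sum, Fintype.card_fin, nsmul_eq_mul]
  push_cast
  rw [← two_mul, ← mul_assoc, ENNReal.inv_mul_cancel (by simp [hd]) (by finiteness), one_mul]

end Transience

/-! ### The first visit to a pair of neighbours -/

section FirstVisit

variable {d : ℕ}

/-- The event that the first visit to the pair `{0, u}` at a positive time takes place at time `s`,
and that the walk is then at `z`. -/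
def firstVisit (u z : Lattice d) (s : ℕ) : Set (ℕ → Lattice d) :=
  {x | 0 < s ∧ pos x s = z ∧ ∀ r, 0 < r → r < s → pos x r ≠ 0 ∧ pos x r ≠ u}

lemma determinedBefore_firstVisit (u z : Lattice d) (s : ℕ) :
    DeterminedBefore s (firstVisit u z s) := by
  rintro x y hxy ⟨h0, h1, h2⟩
  refine ⟨h0, by rw [← pos_congr hxy le_rfl, h1], fun r hr hrs => ?_⟩
  rw [← pos_congr hxy hrs.le]
  exact h2 r hr hrs

lemma firstVisit_eq {u z w : Lattice d} {s t : ℕ} {x : ℕ → Lattice d} (hz : z = 0 ∨ z = u)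
    (hw : w = 0 ∨ w = u) (hs : x ∈ firstVisit u z s) (ht : x ∈ firstVisit u w t) :
    s = t ∧ z = w := by
  obtain ⟨hs0, hs1, hs2⟩ := hs
  obtain ⟨ht0, ht1, ht2⟩ := ht
  have hst : s = t := by
    rcases lt_trichotomy s t with h | h | h
    · have := ht2 s hs0 h
      rcases hz with rfl | rfl
      · exact absurd hs1 this.1
      · exact absurd hs1 this.2
    · exact h
    · have := hs2 t ht0 h
      rcases hw with rfl | rfl
      · exact absurd ht1 this.1
      · exact absurd ht1 this.2
  subst hst
  exact ⟨rfl, by rw [← hs1, ← ht1]⟩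

lemma firstVisit_disjoint {u z : Lattice d} (hz : z = 0 ∨ z = u) :
    Pairwise (Function.onFun Disjoint (firstVisit u z)) := by
  intro s t hst
  exact Set.disjoint_left.2 fun x hx hx' => hst (firstVisit_eq hz hz hx hx').1

lemma firstVisit_cover {u : Lattice d} {x : ℕ → Lattice d} {n : ℕ} (hn : 0 < n)
    (h : pos x n = 0 ∨ pos x n = u) :
    ∃ s, s ≤ n ∧ (x ∈ firstVisit u 0 s ∨ x ∈ firstVisit u u s) := by
  classical
  have hex : ∃ s, 0 < s ∧ (pos x s = 0 ∨ pos x s = u) := ⟨n, hn, h⟩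
  refine ⟨Nat.find hex, Nat.find_min' hex ⟨hn, h⟩, ?_⟩
  obtain ⟨h0, h1⟩ := Nat.find_spec hex
  have hmin : ∀ r, 0 < r → r < Nat.find hex → pos x r ≠ 0 ∧ pos x r ≠ u := by
    intro r hr hlt
    have := Nat.find_min hex hlt
    push Not at this
    exact this hr
  rcases h1 with h1 | h1
  · exact Or.inl ⟨h0, h1, hmin⟩
  · exact Or.inr ⟨h0, h1, hmin⟩

variable [NeZero d]

/-- Decomposition of a hitting probability along the first visit to a pair. -/
lemma pathLaw_hitEvent_decomposition {u z w : Lattice d}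
    (hzw : (z = 0 ∧ w = u) ∨ (z = u ∧ w = 0)) (huz : u ≠ 0) :
    pathLaw d (hitEvent z) = pathLaw d (⋃ s, firstVisit u z s) +
      pathLaw d (⋃ s, firstVisit u w s) * pathLaw d (hitEvent (z - w)) := by
  have hz : z = 0 ∨ z = u := by tauto
  have hw : w = 0 ∨ w = u := by tauto
  have hne : z ≠ w := by
    rcases hzw with ⟨rfl, rfl⟩ | ⟨rfl, rfl⟩
    · exact huz.symm
    · exact huz
  rw [← pathLaw_iUnion_inter_shift (fun s => s) (determinedBefore_firstVisit u w)
    (firstVisit_disjoint hw) (measurableSet_hitEvent _), ← measure_union]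
  · congr 1
    ext x
    constructor
    · rintro ⟨n, hn, hx⟩
      obtain ⟨s, hsn, hs⟩ := firstVisit_cover (u := u) (x := x) (n := n) (by omega)
        (by rw [hx]; exact hz)
      have hs' : x ∈ firstVisit u z s ∨ x ∈ firstVisit u w s := by
        rcases hzw with ⟨rfl, rfl⟩ | ⟨rfl, rfl⟩
        · exact hs
        · exact hs.symm
      rcases hs' with hs' | hs'
      · exact Or.inl (Set.mem_iUnion.2 ⟨s, hs'⟩)
      -- The pair is first met at `w`, and the walk must still travel the displacement `z - w`, in
      -- positive time since `z ≠ w`.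
      · refine Or.inr (Set.mem_iUnion.2 ⟨s, hs', ?_⟩)
        obtain ⟨m, rfl⟩ := Nat.exists_eq_add_of_le hsn
        rw [pos_add, hs'.2.1] at hx
        refine ⟨m, ?_, ?_⟩
        · rcases m with _ | m
          · rw [pos_zero, add_zero] at hx
            exact absurd hx.symm hne
          · omega
        · rw [← hx]; abel
    · rintro (hx | hx)
      · obtain ⟨s, hs⟩ := Set.mem_iUnion.1 hx
        exact ⟨s, hs.1, hs.2.1⟩
      · obtain ⟨s, hs, n, hn, hx⟩ := Set.mem_iUnion.1 hx
        refine ⟨s + n, by omega, ?_⟩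
        rw [pos_add, hs.2.1, hx]; abel
  · refine Set.disjoint_left.2 fun x hx hx' => hne ?_
    obtain ⟨s, hs⟩ := Set.mem_iUnion.1 hx
    obtain ⟨t, ht, _⟩ := Set.mem_iUnion.1 hx'
    exact (firstVisit_eq hz hw hs ht).2
  · refine MeasurableSet.iUnion fun s => ?_
    exact (determinedBefore_firstVisit u w s).measurableSet.inter
      (measurable_shift _ (measurableSet_hitEvent _))

/-- The probability `(1 - γ) / (2 - γ)` that the first visit to a pair of neighbours, from one of
them, is to a given one of them. -/
def pairProb (d : ℕ) [NeZero d] : ℝ :=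
  (pathLaw d).real (hitEvent 0) / (1 + (pathLaw d).real (hitEvent 0))

lemma pairProb_pos : 0 < pairProb d := by
  have : 0 < (pathLaw d).real (hitEvent (0 : Lattice d)) :=
    ENNReal.toReal_pos pathLaw_hitEvent_zero_pos.ne' (measure_ne_top _ _)
  unfold pairProb
  positivity

lemma pathLaw_real_hitEvent_zero_lt_one (hd : 4 ≤ d) :
    (pathLaw d).real (hitEvent (0 : Lattice d)) < 1 := by
  have := (ENNReal.toReal_lt_toReal (measure_ne_top _ _) ENNReal.one_ne_top).2
    (pathLaw_hitEvent_zero_lt_one hd)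
  simpa [measureReal_def] using this

lemma two_mul_pairProb_lt_one (hd : 4 ≤ d) : 2 * pairProb d < 1 := by
  have h1 := pathLaw_real_hitEvent_zero_lt_one hd
  have h0 : 0 ≤ (pathLaw d).real (hitEvent (0 : Lattice d)) := measureReal_nonneg
  unfold pairProb
  rw [← mul_div_assoc, div_lt_one (by linarith)]
  linarith

/-- With `q` and `t` the probabilities for the two sites, the decompositions read `r = q + t r` and
`r = t + q r`. Since `r < 1`, subtraction gives `q = t`, hence `q = r / (1 + r)`. -/
theorem pathLaw_firstVisit (hd : 4 ≤ d) (i : Fin d ⊕ Fin d) {z : Lattice d}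
    (hz : z = 0 ∨ z = unitVec i) :
    (pathLaw d).real (⋃ s, firstVisit (unitVec i) z s) = pairProb d := by
  have h1 := pathLaw_hitEvent_decomposition (u := unitVec i) (z := 0) (w := unitVec i)
    (Or.inl ⟨rfl, rfl⟩) (unitVec_ne_zero i)
  have h2 := pathLaw_hitEvent_decomposition (u := unitVec i) (z := unitVec i) (w := 0)
    (Or.inr ⟨rfl, rfl⟩) (unitVec_ne_zero i)
  rw [zero_sub, ← unitVec_swap, pathLaw_hitEvent_unitVec_eq] at h1
  rw [sub_zero, pathLaw_hitEvent_unitVec_eq] at h2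
  have hr := pathLaw_real_hitEvent_zero_lt_one hd
  have hr0 : 0 ≤ (pathLaw d).real (hitEvent (0 : Lattice d)) := measureReal_nonneg
  have e1 := congrArg ENNReal.toReal h1
  have e2 := congrArg ENNReal.toReal h2
  rw [ENNReal.toReal_add (measure_ne_top _ _) (by finiteness), ENNReal.toReal_mul] at e1 e2
  simp only [← measureReal_def] at e1 e2
  unfold pairProb
  generalize (pathLaw d).real (hitEvent (0 : Lattice d)) = r at *
  set q := (pathLaw d).real (⋃ s, firstVisit (unitVec i) 0 s) with hq
  set t := (pathLaw d).real (⋃ s, firstVisit (unitVec i) (unitVec i) s) with ht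
  have hqt : q = t := by
    have : (q - t) * (1 - r) = 0 := by linarith
    rcases mul_eq_zero.1 this with h | h
    · linarith
    · linarith
  have hqr : q = r / (1 + r) := by
    rw [eq_div_iff (by linarith)]
    rw [hqt] at e1 ⊢
    linarith
  rcases hz with rfl | rfl
  · exact hqr
  · rw [← ht, ← hqt]; exact hqr

/-- The event that the walk never visits the pair `{0, u}` at a positive time. -/
def avoidEvent (u : Lattice d) : Set (ℕ → Lattice d) :=
  {x | ∀ r, 0 < r → pos x r ≠ 0 ∧ pos x r ≠ u}

omit [NeZero d] in
lemma avoidEvent_eq_compl (u : Lattice d) :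
    avoidEvent u = ((⋃ s, firstVisit u 0 s) ∪ (⋃ s, firstVisit u u s))ᶜ := by
  ext x
  simp only [avoidEvent, Set.mem_ofPred_eq, Set.mem_compl_iff, Set.mem_union, Set.mem_iUnion]
  constructor
  · rintro h (⟨s, hs⟩ | ⟨s, hs⟩)
    · exact (h s hs.1).1 hs.2.1
    · exact (h s hs.1).2 hs.2.1
  · intro h r hr
    by_contra hcon
    have : pos x r = 0 ∨ pos x r = u := by tauto
    obtain ⟨s, _, hs⟩ := firstVisit_cover hr this
    rcases hs with hs | hs
    · exact h (Or.inl ⟨s, hs⟩)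
    · exact h (Or.inr ⟨s, hs⟩)

omit [NeZero d] in
lemma measurableSet_iUnion_firstVisit (u z : Lattice d) :
    MeasurableSet (⋃ s, firstVisit u z s) :=
  MeasurableSet.iUnion fun s => (determinedBefore_firstVisit u z s).measurableSet

omit [NeZero d] in
lemma measurableSet_avoidEvent (u : Lattice d) : MeasurableSet (avoidEvent u) := by
  rw [avoidEvent_eq_compl]
  exact ((measurableSet_iUnion_firstVisit _ _).union (measurableSet_iUnion_firstVisit _ _)).compl

theorem pathLaw_avoidEvent (hd : 4 ≤ d) (i : Fin d ⊕ Fin d) :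
    (pathLaw d).real (avoidEvent (unitVec i)) = 1 - 2 * pairProb d := by
  rw [avoidEvent_eq_compl, probReal_compl_eq_one_sub
    ((measurableSet_iUnion_firstVisit _ _).union (measurableSet_iUnion_firstVisit _ _)),
    measureReal_union _ (measurableSet_iUnion_firstVisit _ _),
    pathLaw_firstVisit hd i (Or.inl rfl), pathLaw_firstVisit hd i (Or.inr rfl)]
  · ring
  · refine Set.disjoint_left.2 fun x hx hx' => unitVec_ne_zero i ?_
    obtain ⟨s, hs⟩ := Set.mem_iUnion.1 hx
    obtain ⟨t, ht⟩ := Set.mem_iUnion.1 hx'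
    exact (firstVisit_eq (Or.inl rfl) (Or.inr rfl) hs ht).2.symm

end FirstVisit

/-! ### Weights of two-letter words -/

/-- The total weight of the words with `k` letters of one kind and `l` of another, each letter
having weight `β`. -/
def wordWeight (β : ℝ) (k l : ℕ) : ℝ := (k + l).choose k * β ^ (k + l)

lemma wordWeight_comm (β : ℝ) (k l : ℕ) : wordWeight β k l = wordWeight β l k := by
  unfold wordWeight
  rw [add_comm l k, Nat.choose_symm_add]

lemma wordWeight_succ_zero (β : ℝ) (k : ℕ) : wordWeight β (k + 1) 0 = β * wordWeight β k 0 := by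
  simp [wordWeight, pow_succ']

lemma wordWeight_zero_succ (β : ℝ) (l : ℕ) : wordWeight β 0 (l + 1) = β * wordWeight β 0 l := by
  simp [wordWeight, pow_succ']

/-- Pascal's rule, read as conditioning on the first letter: which site of the pair is visited
first. -/
lemma wordWeight_succ_succ (β : ℝ) (k l : ℕ) :
    wordWeight β (k + 1) (l + 1) = β * wordWeight β k (l + 1) + β * wordWeight β (k + 1) l := by
  unfold wordWeight
  rw [show k + 1 + (l + 1) = (k + l + 1) + 1 by ring, show k + (l + 1) = k + l + 1 by ring,
    show k + 1 + l = k + l + 1 by ring, Nat.choose_succ_succ]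
  push_cast
  ring

/-! ### Renewal of the visit counts -/

section Visits

variable {d : ℕ}

lemma visits_firstVisit_self {u z : Lattice d} {s : ℕ} {x : ℕ → Lattice d} (hz : z = 0 ∨ z = u)
    (hx : x ∈ firstVisit u z s) : visits x z s = 1 := by
  obtain ⟨h0, h1, h2⟩ := hx
  obtain ⟨r, rfl⟩ := Nat.exists_eq_succ_of_ne_zero h0.ne'
  rw [Nat.succ_eq_add_one, visits_succ, if_pos h1, (visits_eq_zero_iff x z r).2]
  intro s hs hsr
  have := h2 s hs (Nat.lt_succ_of_le hsr)
  rcases hz with rfl | rfl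
  · exact this.1
  · exact this.2

lemma visits_firstVisit_other {u z w : Lattice d} {s : ℕ} {x : ℕ → Lattice d}
    (hw : w = 0 ∨ w = u) (hzw : z ≠ w) (hx : x ∈ firstVisit u z s) : visits x w s = 0 := by
  obtain ⟨h0, h1, h2⟩ := hx
  rw [visits_eq_zero_iff]
  intro r hr hrs
  rcases hrs.lt_or_eq with h | rfl
  · have := h2 r hr h
    rcases hw with rfl | rfl
    · exact this.1
    · exact this.2
  · rw [h1]; exact hzw

lemma visits_after_firstVisit_zero {u : Lattice d} (hu : u ≠ 0) {s : ℕ} {x : ℕ → Lattice d}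
    (hx : x ∈ firstVisit u 0 s) (m : ℕ) :
    visits x 0 (s + m) = visits (shift s x) 0 m + 1 ∧
      visits x u (s + m) = visits (shift s x) u m := by
  rw [visits_add, visits_add, hx.2.1, visits_firstVisit_self (Or.inl rfl) hx,
    visits_firstVisit_other (Or.inr rfl) hu.symm hx]
  simp [add_comm]

/-- Seen from `u`, the old origin is the neighbour `-u`: the two counts exchange roles and the
direction is reversed. -/
lemma visits_after_firstVisit_neighbour {u : Lattice d} (hu : u ≠ 0) {s : ℕ} {x : ℕ → Lattice d}
    (hx : x ∈ firstVisit u u s) (m : ℕ) :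
    visits x 0 (s + m) = visits (shift s x) (-u) m ∧
      visits x u (s + m) = visits (shift s x) 0 m + 1 := by
  rw [visits_add, visits_add, hx.2.1, visits_firstVisit_self (Or.inr rfl) hx,
    visits_firstVisit_other (Or.inl rfl) hu hx]
  simp [add_comm]

lemma determinedBefore_visits_eq {m n : ℕ} (h : n ≤ m) (z : Lattice d) (k : ℕ) :
    DeterminedBefore m {x | visits x z n = k} := by
  intro x y hxy hx
  simp only [Set.mem_ofPred_eq] at hx ⊢
  rw [← visits_congr hxy h, hx]

/-- The event that at some time the walk has made `k` visits to `0` and `l` visits to `u`. -/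
def reachEvent (k l : ℕ) (u : Lattice d) : Set (ℕ → Lattice d) :=
  {x | ∃ r, visits x 0 r = k ∧ visits x u r = l}

/-- The event that from time `N` on the walk has made `k` visits to `0` and `l` visits to `u`. -/
def stableEvent (k l : ℕ) (u : Lattice d) (N : ℕ) : Set (ℕ → Lattice d) :=
  {x | ∀ r, N ≤ r → visits x 0 r = k ∧ visits x u r = l}

lemma determinedBefore_visits_pair (k l n : ℕ) (u : Lattice d) :
    DeterminedBefore n {x | visits x 0 n = k ∧ visits x u n = l} :=
  (determinedBefore_visits_eq le_rfl 0 k).inter (determinedBefore_visits_eq le_rfl u l)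

lemma measurableSet_reachEvent (k l : ℕ) (u : Lattice d) : MeasurableSet (reachEvent k l u) := by
  have : reachEvent k l u = ⋃ r, {x | visits x 0 r = k ∧ visits x u r = l} := by
    ext x; simp [reachEvent]
  rw [this]
  exact MeasurableSet.iUnion fun r => (determinedBefore_visits_pair k l r u).measurableSet

lemma measurableSet_stableEvent (k l : ℕ) (u : Lattice d) (N : ℕ) :
    MeasurableSet (stableEvent k l u N) := by
  have : stableEvent k l u N = ⋂ r, ⋂ _ : N ≤ r, {x | visits x 0 r = k ∧ visits x u r = l} := by
    ext x; simp [stableEvent]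
  rw [this]
  exact MeasurableSet.iInter fun r => MeasurableSet.iInter fun _ =>
    (determinedBefore_visits_pair k l r u).measurableSet

lemma reachEvent_subset {k l : ℕ} {u : Lattice d} (hu : u ≠ 0) (hkl : k ≠ 0 ∨ l ≠ 0)
    {x : ℕ → Lattice d} (hx : x ∈ reachEvent k l u) :
    (∃ k', k = k' + 1 ∧ x ∈ ⋃ s, (firstVisit u 0 s ∩ shift s ⁻¹' reachEvent k' l u)) ∨
      (∃ l', l = l' + 1 ∧ x ∈ ⋃ s, (firstVisit u u s ∩ shift s ⁻¹' reachEvent l' k (-u))) := by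
  obtain ⟨r, hk, hl⟩ := hx
  have hvis : ∃ n, 0 < n ∧ n ≤ r ∧ (pos x n = 0 ∨ pos x n = u) := by
    by_contra hcon
    push Not at hcon
    rcases hkl with h | h
    · exact h (hk ▸ (visits_eq_zero_iff _ _ _).2 fun s hs hsr => (hcon s hs hsr).1)
    · exact h (hl ▸ (visits_eq_zero_iff _ _ _).2 fun s hs hsr => (hcon s hs hsr).2)
  obtain ⟨n, hn, hnr, hx⟩ := hvis
  obtain ⟨s, hsn, hs⟩ := firstVisit_cover hn hx
  obtain ⟨m, rfl⟩ := Nat.exists_eq_add_of_le (hsn.trans hnr)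
  rcases hs with hs | hs
  · obtain ⟨h1, h2⟩ := visits_after_firstVisit_zero hu hs m
    exact Or.inl ⟨visits (shift s x) 0 m, by omega, Set.mem_iUnion.2 ⟨s, hs, m, rfl, by omega⟩⟩
  · obtain ⟨h1, h2⟩ := visits_after_firstVisit_neighbour hu hs m
    exact Or.inr ⟨visits (shift s x) 0 m, by omega, Set.mem_iUnion.2 ⟨s, hs, m, rfl, by omega⟩⟩

/-- Waiting times for the next visit are capped at `t`, so each letter of the word delays
stabilisation by at most `t`. -/
lemma firstVisit_zero_inter_stableEvent_subset {k l t N : ℕ} {u : Lattice d} (hu : u ≠ 0) :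
    (⋃ s : Fin (t + 1), (firstVisit u 0 s ∩ shift s ⁻¹' stableEvent k l u N)) ⊆
      stableEvent (k + 1) l u (t + N) := by
  intro x hx r hr
  obtain ⟨s, hs, hx⟩ := Set.mem_iUnion.1 hx
  have hst : (s : ℕ) ≤ t := Nat.lt_succ_iff.1 s.2
  obtain ⟨m, rfl⟩ := Nat.exists_eq_add_of_le (hst.trans ((Nat.le_add_right t N).trans hr))
  obtain ⟨h1, h2⟩ := visits_after_firstVisit_zero hu hs m
  obtain ⟨h3, h4⟩ := hx m (by omega)
  exact ⟨by omega, by omega⟩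

lemma firstVisit_neighbour_inter_stableEvent_subset {k l t N : ℕ} {u : Lattice d} (hu : u ≠ 0) :
    (⋃ s : Fin (t + 1), (firstVisit u u s ∩ shift s ⁻¹' stableEvent l k (-u) N)) ⊆
      stableEvent k (l + 1) u (t + N) := by
  intro x hx r hr
  obtain ⟨s, hs, hx⟩ := Set.mem_iUnion.1 hx
  have hst : (s : ℕ) ≤ t := Nat.lt_succ_iff.1 s.2
  obtain ⟨m, rfl⟩ := Nat.exists_eq_add_of_le (hst.trans ((Nat.le_add_right t N).trans hr))
  obtain ⟨h1, h2⟩ := visits_after_firstVisit_neighbour hu hs m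
  obtain ⟨h3, h4⟩ := hx m (by omega)
  exact ⟨by omega, by omega⟩

end Visits

/-! ### Probabilities of prescribed counts -/

section Probabilities

variable {d : ℕ} [NeZero d]

/-- The index type allows both all times, for the upper bound, and a bounded range of times, for the
lower bound. -/
lemma pathLaw_real_firstVisit_inter {ι : Type*} [Countable ι] {τ : ι → ℕ}
    (hτ : Function.Injective τ) {u z : Lattice d} (hz : z = 0 ∨ z = u)
    {B : Set (ℕ → Lattice d)} (hB : MeasurableSet B) :
    (pathLaw d).real (⋃ s, (firstVisit u z (τ s) ∩ shift (τ s) ⁻¹' B)) =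
      (pathLaw d).real (⋃ s, firstVisit u z (τ s)) * (pathLaw d).real B := by
  simp only [measureReal_def]
  rw [pathLaw_iUnion_inter_shift τ (fun s => determinedBefore_firstVisit u z (τ s)) _ hB,
    ENNReal.toReal_mul]
  exact fun s t hst => firstVisit_disjoint hz fun h => hst (hτ h)

/-- The probability of ever seeing given numbers of visits to two neighbours. -/
theorem pathLaw_reachEvent_le (hd : 4 ≤ d) (k l : ℕ) (i : Fin d ⊕ Fin d) :
    (pathLaw d).real (reachEvent k l (unitVec i)) ≤ wordWeight (pairProb d) k l := by
  have hα := (pairProb_pos (d := d)).le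
  have h0 : ∀ (k' l : ℕ) (i : Fin d ⊕ Fin d), (pathLaw d).real
      (⋃ s, (firstVisit (unitVec i) 0 s ∩ shift s ⁻¹' reachEvent k' l (unitVec i))) =
        pairProb d * (pathLaw d).real (reachEvent k' l (unitVec i)) := by
    intro k' l i
    rw [pathLaw_real_firstVisit_inter (τ := fun s => s) (fun _ _ h => h) (Or.inl rfl)
      (measurableSet_reachEvent _ _ _), pathLaw_firstVisit hd i (Or.inl rfl)]
  have h1 : ∀ (l' k : ℕ) (i : Fin d ⊕ Fin d), (pathLaw d).real
      (⋃ s, (firstVisit (unitVec i) (unitVec i) s ∩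
        shift s ⁻¹' reachEvent l' k (-unitVec i))) =
        pairProb d * (pathLaw d).real (reachEvent l' k (unitVec i.swap)) := by
    intro l' k i
    rw [pathLaw_real_firstVisit_inter (τ := fun s => s) (fun _ _ h => h) (Or.inr rfl)
      (measurableSet_reachEvent _ _ _), pathLaw_firstVisit hd i (Or.inr rfl), unitVec_swap]
  -- The direction must vary, since a visit to the neighbour replaces `i` by `i.swap` and exchanges
  -- `k` and `l`.
  induction hn : k + l generalizing k l i with
  | zero =>
    obtain ⟨rfl, rfl⟩ : k = 0 ∧ l = 0 := by omega
    simp [wordWeight]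
  | succ n ih =>
    rcases k with _ | k <;> rcases l with _ | l
    · omega
    · rw [wordWeight_zero_succ, wordWeight_comm]
      refine le_trans ?_ (mul_le_mul_of_nonneg_left (ih l 0 i.swap (by omega)) hα)
      rw [← h1]
      refine measureReal_mono fun x hx => ?_
      rcases reachEvent_subset (unitVec_ne_zero i) (by omega) hx with ⟨k', hk, hx⟩ | ⟨l', hl, hx⟩
      · omega
      · obtain rfl : l = l' := by omega
        exact hx
    · rw [wordWeight_succ_zero]
      refine le_trans ?_ (mul_le_mul_of_nonneg_left (ih k 0 i (by omega)) hα)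
      rw [← h0]
      refine measureReal_mono fun x hx => ?_
      rcases reachEvent_subset (unitVec_ne_zero i) (by omega) hx with ⟨k', hk, hx⟩ | ⟨l', hl, hx⟩
      · obtain rfl : k = k' := by omega
        exact hx
      · omega
    · rw [wordWeight_succ_succ, wordWeight_comm _ (k + 1) l]
      refine le_trans ?_ (add_le_add (mul_le_mul_of_nonneg_left (ih k (l + 1) i (by omega)) hα)
        (mul_le_mul_of_nonneg_left (ih l (k + 1) i.swap (by omega)) hα))
      rw [← h0, ← h1]
      refine le_trans (measureReal_mono fun x hx => ?_) (measureReal_union_le _ _)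
      rcases reachEvent_subset (unitVec_ne_zero i) (by omega) hx with ⟨k', hk, hx⟩ | ⟨l', hl, hx⟩
      · obtain rfl : k = k' := by omega
        exact Or.inl hx
      · obtain rfl : l = l' := by omega
        exact Or.inr hx

/-- A lower bound for the probability that the numbers of visits to two neighbours quickly take
given values and never change afterwards. -/
theorem le_pathLaw_stableEvent (hd : 4 ≤ d) {β : ℝ} (hβ : 0 ≤ β) {t : ℕ}
    (ht : ∀ (i : Fin d ⊕ Fin d) (z : Lattice d), (z = 0 ∨ z = unitVec i) →
      β ≤ (pathLaw d).real (⋃ s : Fin (t + 1), firstVisit (unitVec i) z s))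
    (k l : ℕ) (i : Fin d ⊕ Fin d) :
    wordWeight β k l * (1 - 2 * pairProb d) ≤
      (pathLaw d).real (stableEvent k l (unitVec i) ((k + l) * t)) := by
  have h0 : ∀ (k l N : ℕ) (i : Fin d ⊕ Fin d),
      β * (pathLaw d).real (stableEvent k l (unitVec i) N) ≤ (pathLaw d).real
      (⋃ s : Fin (t + 1), (firstVisit (unitVec i) 0 s ∩
        shift s ⁻¹' stableEvent k l (unitVec i) N)) := by
    intro k l N i
    rw [pathLaw_real_firstVisit_inter Fin.val_injective (Or.inl rfl)
      (measurableSet_stableEvent _ _ _ _)]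
    exact mul_le_mul_of_nonneg_right (ht i 0 (Or.inl rfl)) measureReal_nonneg
  have h1 : ∀ (k l N : ℕ) (i : Fin d ⊕ Fin d),
      β * (pathLaw d).real (stableEvent l k (unitVec i.swap) N) ≤ (pathLaw d).real
      (⋃ s : Fin (t + 1), (firstVisit (unitVec i) (unitVec i) s ∩
        shift s ⁻¹' stableEvent l k (-unitVec i) N)) := by
    intro k l N i
    rw [pathLaw_real_firstVisit_inter Fin.val_injective (Or.inr rfl)
      (measurableSet_stableEvent _ _ _ _), unitVec_swap]
    exact mul_le_mul_of_nonneg_right (ht i _ (Or.inr rfl)) measureReal_nonneg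
  induction hn : k + l generalizing k l i with
  | zero =>
    obtain ⟨rfl, rfl⟩ : k = 0 ∧ l = 0 := by omega
    have : wordWeight β 0 0 = 1 := by simp [wordWeight]
    -- The empty word: the factor `1 - 2α` is the probability that the pair is never visited again.
    rw [this, one_mul, ← pathLaw_avoidEvent hd i]
    refine measureReal_mono fun x hx r _ => ⟨?_, ?_⟩
    · exact (visits_eq_zero_iff _ _ _).2 fun s hs _ => (hx s hs).1
    · exact (visits_eq_zero_iff _ _ _).2 fun s hs _ => (hx s hs).2
  | succ n ih =>
    have hN : (n + 1) * t = t + n * t := by ring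
    rw [hN]
    rcases k with _ | k <;> rcases l with _ | l
    · omega
    · rw [wordWeight_zero_succ, wordWeight_comm, mul_assoc]
      refine (mul_le_mul_of_nonneg_left (ih l 0 i.swap (by omega)) hβ).trans ((h1 _ _ _ _).trans ?_)
      exact measureReal_mono (firstVisit_neighbour_inter_stableEvent_subset (unitVec_ne_zero i))
    · rw [wordWeight_succ_zero, mul_assoc]
      refine (mul_le_mul_of_nonneg_left (ih k 0 i (by omega)) hβ).trans ((h0 _ _ _ _).trans ?_)
      exact measureReal_mono (firstVisit_zero_inter_stableEvent_subset (unitVec_ne_zero i))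
    · rw [wordWeight_succ_succ, wordWeight_comm _ (k + 1) l, add_mul, mul_assoc, mul_assoc]
      refine (add_le_add
        ((mul_le_mul_of_nonneg_left (ih k (l + 1) i (by omega)) hβ).trans (h0 _ _ _ _))
        ((mul_le_mul_of_nonneg_left (ih l (k + 1) i.swap (by omega)) hβ).trans
          (h1 _ _ _ _))).trans ?_
      rw [← measureReal_union]
      · refine measureReal_mono (Set.union_subset ?_ ?_)
        · exact firstVisit_zero_inter_stableEvent_subset (unitVec_ne_zero i)
        · exact firstVisit_neighbour_inter_stableEvent_subset (unitVec_ne_zero i)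
      · refine Set.disjoint_left.2 fun x hx hx' => unitVec_ne_zero i ?_
        obtain ⟨s, hs, _⟩ := Set.mem_iUnion.1 hx
        obtain ⟨s', hs', _⟩ := Set.mem_iUnion.1 hx'
        exact (firstVisit_eq (Or.inl rfl) (Or.inr rfl) hs hs').2.symm
      · exact MeasurableSet.iUnion fun s => (determinedBefore_firstVisit _ _ _).measurableSet.inter
          (measurable_shift _ (measurableSet_stableEvent _ _ _ _))

/-- The first visit to a pair of neighbours mostly takes place within a bounded time. -/
theorem exists_le_pathLaw_firstVisit (hd : 4 ≤ d) {β : ℝ} (hβ : β < pairProb d) :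
    ∃ t : ℕ, ∀ (i : Fin d ⊕ Fin d) (z : Lattice d), (z = 0 ∨ z = unitVec i) →
      β ≤ (pathLaw d).real (⋃ s : Fin (t + 1), firstVisit (unitVec i) z s) := by
  have key : ∀ (i : Fin d ⊕ Fin d) (z : Lattice d), (z = 0 ∨ z = unitVec i) →
      ∀ᶠ t : ℕ in Filter.atTop,
        β ≤ (pathLaw d).real (⋃ s : Fin (t + 1), firstVisit (unitVec i) z s) := by
    intro i z hz
    have hmono : Monotone fun t : ℕ => ⋃ s : Fin (t + 1), firstVisit (unitVec i) z s := by
      intro a b hab x hx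
      obtain ⟨s, hs⟩ := Set.mem_iUnion.1 hx
      exact Set.mem_iUnion.2 ⟨⟨s, by have := s.2; omega⟩, hs⟩
    have hU : (⋃ t : ℕ, ⋃ s : Fin (t + 1), firstVisit (unitVec i) z s) =
        ⋃ s : ℕ, firstVisit (unitVec i) z s := by
      ext x
      simp only [Set.mem_iUnion]
      constructor
      · rintro ⟨t, s, hs⟩
        exact ⟨s, hs⟩
      · rintro ⟨s, hs⟩
        exact ⟨s, ⟨s, Nat.lt_succ_self s⟩, hs⟩
    have h := tendsto_measure_iUnion_atTop (μ := pathLaw d) hmono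
    rw [hU] at h
    have h' := (ENNReal.tendsto_toReal (measure_ne_top _ _)).comp h
    rw [← measureReal_def, pathLaw_firstVisit hd i hz] at h'
    filter_upwards [h'.eventually (lt_mem_nhds hβ)] with t ht using ht.le
  have h1 : ∀ᶠ t : ℕ in Filter.atTop, ∀ i : Fin d ⊕ Fin d,
      β ≤ (pathLaw d).real (⋃ s : Fin (t + 1), firstVisit (unitVec i) 0 s) :=
    Filter.eventually_all.2 fun i => key i 0 (Or.inl rfl)
  have h2 : ∀ᶠ t : ℕ in Filter.atTop, ∀ i : Fin d ⊕ Fin d,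
      β ≤ (pathLaw d).real (⋃ s : Fin (t + 1), firstVisit (unitVec i) (unitVec i) s) :=
    Filter.eventually_all.2 fun i => key i _ (Or.inr rfl)
  obtain ⟨t, ht1, ht2⟩ := (h1.and h2).exists
  refine ⟨t, fun i z hz => ?_⟩
  rcases hz with rfl | rfl
  · exact ht1 i
  · exact ht2 i

end Probabilities

/-! ### The rate function and binomial asymptotics -/

section Rate

/-- The function whose sublevel set at height `1` is the region `𝓑`. -/
def rate (α x y : ℝ) : ℝ :=
  -(x + y) * Real.log (x + y) + x * Real.log x + y * Real.log y - (x + y) * Real.log α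

lemma rate_eq_negMulLog (α x y : ℝ) : rate α x y =
    Real.negMulLog (x + y) - Real.negMulLog x - Real.negMulLog y - (x + y) * Real.log α := by
  simp [rate, Real.negMulLog]

lemma rate_comm (α x y : ℝ) : rate α x y = rate α y x := by
  unfold rate
  rw [add_comm y x]
  ring

@[simp] lemma rate_zero_zero (α : ℝ) : rate α 0 0 = 0 := by simp [rate]

/-- The `log c` contributions cancel because `x + y` balances `x` and `y`. This is why dilating `𝓑`
amounts to changing the height. -/
lemma rate_mul (α c x y : ℝ) : rate α (c * x) (c * y) = c * rate α x y := by
  rw [rate_eq_negMulLog, rate_eq_negMulLog, ← mul_add, Real.negMulLog_mul, Real.negMulLog_mul,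
    Real.negMulLog_mul]
  ring

/-- Midpoint concavity of `Real.negMulLog` bounds the entropy term by `(x + y) log 2`. For `2α < 1`
the rate then grows linearly. -/
lemma mul_add_le_rate {α x y : ℝ} (hα : 0 < α) (hx : 0 ≤ x) (hy : 0 ≤ y) :
    -Real.log (2 * α) * (x + y) ≤ rate α x y := by
  have h := Real.concaveOn_negMulLog.2 (Set.mem_Ici.2 hx) (Set.mem_Ici.2 hy)
    (by norm_num : (0 : ℝ) ≤ 1 / 2) (by norm_num : (0 : ℝ) ≤ 1 / 2) (by norm_num)
  simp only [smul_eq_mul] at h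
  rw [← mul_add, ← mul_add, Real.negMulLog_mul] at h
  have h2 : Real.negMulLog (1 / 2) = 1 / 2 * Real.log 2 := by
    rw [Real.negMulLog, one_div, Real.log_inv]; ring
  rw [h2] at h
  rw [rate_eq_negMulLog, Real.log_mul (by norm_num) hα.ne']
  linarith

lemma mem_smul_regionB {γ c x y : ℝ} (hc : 0 < c) (hx : 0 ≤ x) (hy : 0 ≤ y) :
    (x, y) ∈ c • regionB γ ↔ rate ((1 - γ) / (2 - γ)) x y ≤ c := by
  rw [Set.mem_smul_set_iff_inv_smul_mem₀ hc.ne']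
  have h : rate ((1 - γ) / (2 - γ)) (c⁻¹ * x) (c⁻¹ * y) ≤ 1 ↔
      rate ((1 - γ) / (2 - γ)) x y ≤ c := by
    rw [rate_mul, inv_mul_le_iff₀ hc, mul_one]
  rw [← h]
  constructor
  · rintro ⟨_, _, h3⟩
    exact h3
  · intro h3
    exact ⟨mul_nonneg (inv_nonneg.2 hc.le) hx, mul_nonneg (inv_nonneg.2 hc.le) hy, h3⟩

/-- This covers `ε ≥ 1` in the lower bound: for `c ≤ 0` the dilate lies in the opposite quadrant,
which leaves only the origin. -/
lemma rate_le_of_mem_smul_regionB {γ c x y : ℝ} (hx : 0 ≤ x) (hy : 0 ≤ y)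
    (h : (x, y) ∈ c • regionB γ) : rate ((1 - γ) / (2 - γ)) x y ≤ max c 0 := by
  rcases lt_or_ge 0 c with hc | hc
  · exact ((mem_smul_regionB hc hx hy).1 h).trans (le_max_left _ _)
  · obtain ⟨v, ⟨hv1, hv2, _⟩, hv⟩ := h
    have h1 : c * v.1 = x := congrArg Prod.fst hv
    have h2 : c * v.2 = y := congrArg Prod.snd hv
    have hx0 : x = 0 := le_antisymm (h1 ▸ mul_nonpos_of_nonpos_of_nonneg hc hv1) hx
    have hy0 : y = 0 := le_antisymm (h2 ▸ mul_nonpos_of_nonpos_of_nonneg hc hv2) hy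
    rw [hx0, hy0, rate_zero_zero]
    exact le_max_right _ _

lemma exp_nat_mul_log (n : ℕ) : Real.exp (n * Real.log n) = (n : ℝ) ^ n := by
  rcases n.eq_zero_or_pos with rfl | hn
  · simp
  · rw [Real.exp_nat_mul, Real.exp_log (by exact_mod_cast hn)]

lemma exp_neg_rate {α : ℝ} (hα : 0 < α) (k l : ℕ) :
    Real.exp (-rate α k l) =
      ((k + l : ℕ) : ℝ) ^ (k + l) * α ^ (k + l) / ((k : ℝ) ^ k * (l : ℝ) ^ l) := by
  have h : -rate α k l = ((k + l : ℕ) : ℝ) * Real.log ((k + l : ℕ) : ℝ) +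
      ((k + l : ℕ) : ℝ) * Real.log α - (k * Real.log k + l * Real.log l) := by
    unfold rate; push_cast; ring
  rw [h, Real.exp_sub, Real.exp_add, Real.exp_add, exp_nat_mul_log, exp_nat_mul_log,
    exp_nat_mul_log, Real.exp_nat_mul, Real.exp_log hα]

lemma nat_pow_self_pos (n : ℕ) : (0 : ℝ) < (n : ℝ) ^ n := by
  rw [← exp_nat_mul_log]; exact Real.exp_pos _

/-- The term `(k + l choose k) k ^ k l ^ l` is one summand in the binomial expansion of `(k + l) ^
(k + l)`. -/
lemma wordWeight_le_exp_neg_rate {α : ℝ} (hα : 0 < α) (k l : ℕ) :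
    wordWeight α k l ≤ Real.exp (-rate α k l) := by
  have hk := nat_pow_self_pos k
  have hl := nat_pow_self_pos l
  rw [exp_neg_rate hα, le_div_iff₀ (by positivity)]
  have h : ((k + l).choose k * (k ^ k * l ^ l) : ℝ) ≤ ((k + l : ℕ) : ℝ) ^ (k + l) := by
    push_cast
    rw [add_pow]
    have := Finset.single_le_sum (f := fun m => (k : ℝ) ^ m * (l : ℝ) ^ (k + l - m) *
      ((k + l).choose m : ℝ)) (s := Finset.range (k + l + 1)) (fun m _ => by positivity)
      (Finset.mem_range.2 (by omega : k < k + l + 1))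
    simp only [Nat.add_sub_cancel_left] at this
    linarith
  unfold wordWeight
  calc ((k + l).choose k : ℝ) * α ^ (k + l) * ((k : ℝ) ^ k * (l : ℝ) ^ l)
      = ((k + l).choose k * (k ^ k * l ^ l)) * α ^ (k + l) := by ring
    _ ≤ _ := by gcongr

/-- A crude Stirling bound, by induction from `(1 - 1 / a) ^ a ≤ exp (-1)`. For `n ≥ 1` the
induction carries the factor `n`; the weaker `n + 1` also admits `n = 0`. -/
lemma factorial_mul_exp_le (n : ℕ) :
    (n.factorial : ℝ) * Real.exp n ≤ Real.exp 1 * (n + 1) * (n : ℝ) ^ n := by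
  suffices h : ∀ m : ℕ, ((m + 1).factorial : ℝ) * Real.exp (m + 1) ≤
      Real.exp 1 * (m + 1) * ((m : ℝ) + 1) ^ (m + 1) by
    rcases n with _ | m
    · simp
    · have h1 := h m
      push_cast
      refine h1.trans ?_
      gcongr
      linarith
  intro m
  induction m with
  | zero => simp
  | succ m ih =>
    have hm : (0 : ℝ) ≤ m := Nat.cast_nonneg m
    have h1 : Real.exp 1 * ((m : ℝ) + 1) ^ (m + 2) ≤ ((m : ℝ) + 2) ^ (m + 2) := by
      have h2 : 1 - 1 / ((m : ℝ) + 2) ≤ Real.exp (-(1 / ((m : ℝ) + 2))) := by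
        have := Real.add_one_le_exp (-(1 / ((m : ℝ) + 2)))
        linarith
      have h3 : 1 - 1 / ((m : ℝ) + 2) = ((m : ℝ) + 1) / (m + 2) := by
        field_simp; ring
      rw [h3] at h2
      have h4 : (((m : ℝ) + 1) / (m + 2)) ^ (m + 2) ≤
          Real.exp (-(1 / ((m : ℝ) + 2))) ^ (m + 2) := by gcongr
      rw [← Real.exp_nat_mul] at h4
      have h5 : ((m + 2 : ℕ) : ℝ) * -(1 / ((m : ℝ) + 2)) = -1 := by
        push_cast; field_simp
      rw [h5, Real.exp_neg, div_pow, div_le_iff₀ (by positivity), inv_mul_eq_div,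
        le_div_iff₀ (Real.exp_pos 1)] at h4
      linarith
    rw [Nat.factorial_succ]
    push_cast
    calc ((m : ℝ) + 1 + 1) * ((m + 1).factorial : ℝ) * Real.exp (m + 1 + 1)
        = ((m : ℝ) + 2) * Real.exp 1 * (((m + 1).factorial : ℝ) * Real.exp (m + 1)) := by
          rw [Real.exp_add (m + 1 : ℝ) 1]; ring
      _ ≤ ((m : ℝ) + 2) * Real.exp 1 * (Real.exp 1 * (m + 1) * ((m : ℝ) + 1) ^ (m + 1)) := by
          gcongr
      _ = ((m : ℝ) + 2) * Real.exp 1 * (Real.exp 1 * ((m : ℝ) + 1) ^ (m + 2)) := by ring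
      _ ≤ ((m : ℝ) + 2) * Real.exp 1 * ((m : ℝ) + 2) ^ (m + 2) := by gcongr
      _ = Real.exp 1 * ((m : ℝ) + 1 + 1) * ((m : ℝ) + 1 + 1) ^ (m + 1 + 1) := by ring

lemma exp_neg_rate_le_wordWeight {α : ℝ} (hα : 0 < α) (k l : ℕ) :
    Real.exp (-rate α k l) ≤ Real.exp 1 ^ 2 * ((k + 1) * (l + 1)) * wordWeight α k l := by
  have hk := nat_pow_self_pos k
  have hl := nat_pow_self_pos l
  rw [exp_neg_rate hα, div_le_iff₀ (by positivity)]
  have h1 := factorial_mul_exp_le k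
  have h2 := factorial_mul_exp_le l
  have h3 := Real.pow_div_factorial_le_exp ((k + l : ℕ) : ℝ) (by positivity) (k + l)
  have hf : (0 : ℝ) < (k + l).factorial := by exact_mod_cast Nat.factorial_pos _
  rw [div_le_iff₀ hf] at h3
  have h4 : ((k + l).factorial : ℝ) = (k + l).choose k * (k.factorial * l.factorial) := by
    have := Nat.add_choose_mul_factorial_mul_factorial k l
    rw [← this, Nat.choose_symm_add]; push_cast; ring
  have h5 : ((k + l : ℕ) : ℝ) ^ (k + l) ≤ Real.exp 1 ^ 2 * ((k + 1) * (l + 1)) *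
      ((k + l).choose k * ((k : ℝ) ^ k * (l : ℝ) ^ l)) := by
    refine h3.trans ?_
    rw [h4]
    push_cast
    rw [Real.exp_add]
    calc Real.exp k * Real.exp l * (((k + l).choose k : ℝ) * (k.factorial * l.factorial))
        = ((k + l).choose k : ℝ) * ((k.factorial * Real.exp k) * (l.factorial * Real.exp l)) := by
          ring
      _ ≤ ((k + l).choose k : ℝ) * ((Real.exp 1 * (k + 1) * (k : ℝ) ^ k) *
            (Real.exp 1 * (l + 1) * (l : ℝ) ^ l)) := by gcongr
      _ = _ := by ring
  unfold wordWeight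
  calc ((k + l : ℕ) : ℝ) ^ (k + l) * α ^ (k + l)
      ≤ (Real.exp 1 ^ 2 * ((k + 1) * (l + 1)) *
        ((k + l).choose k * ((k : ℝ) ^ k * (l : ℝ) ^ l))) * α ^ (k + l) := by gcongr
    _ = _ := by ring

/-- The polynomial loss in Stirling's bound is absorbed by an arbitrarily small exponential in `k +
l`. -/
lemma exists_exp_neg_rate_le {α η : ℝ} (hα : 0 < α) (hη : 0 < η) :
    ∃ C : ℝ, 0 < C ∧ ∀ k l : ℕ,
      Real.exp (-rate α k l - η * (k + l)) ≤ C * wordWeight α k l := by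
  refine ⟨Real.exp 1 ^ 2 * (1 + 1 / η) ^ 2, by positivity, fun k l => ?_⟩
  have key : ∀ k : ℕ, (k : ℝ) + 1 ≤ (1 + 1 / η) * Real.exp (η * k) := by
    intro k
    have h1 := Real.add_one_le_exp (η * k)
    have hk : (0 : ℝ) ≤ k := Nat.cast_nonneg k
    calc (k : ℝ) + 1 ≤ (1 + 1 / η) * (η * k + 1) := by
          have : (1 + 1 / η) * (η * k + 1) = η * k + 1 + k + 1 / η := by field_simp; ring
          rw [this]
          have := mul_nonneg hη.le hk
          have : 0 ≤ 1 / η := by positivity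
          linarith
      _ ≤ _ := by gcongr
  have hw : 0 ≤ wordWeight α k l := by unfold wordWeight; positivity
  rw [Real.exp_sub, div_le_iff₀ (Real.exp_pos _)]
  refine (exp_neg_rate_le_wordWeight hα k l).trans ?_
  calc Real.exp 1 ^ 2 * (((k : ℝ) + 1) * (l + 1)) * wordWeight α k l
      ≤ Real.exp 1 ^ 2 * (((1 + 1 / η) * Real.exp (η * k)) * ((1 + 1 / η) * Real.exp (η * l))) *
          wordWeight α k l := by
        gcongr
        · exact key k
        · exact key l
    _ = _ := by rw [mul_add, Real.exp_add]; ring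

/-- Counting from the first visit misses that visit itself; this restores it at the price of a
constant. -/
lemma wordWeight_le_succ {α : ℝ} (hα : 0 < α) (k l : ℕ) :
    wordWeight α k l ≤ α⁻¹ * wordWeight α (k + 1) l := by
  unfold wordWeight
  rw [show k + 1 + l = k + l + 1 by ring, pow_succ, Nat.choose_succ_succ]
  push_cast
  have : α⁻¹ * ((((k + l).choose k : ℝ) + ((k + l).choose (k + 1) : ℝ)) * (α ^ (k + l) * α)) =
      (((k + l).choose k : ℝ) + ((k + l).choose (k + 1) : ℝ)) * α ^ (k + l) := by
    field_simp
  rw [this]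
  gcongr
  simp

end Rate

/-! ### Summability and the upper bound -/

/-- A criterion for the summability of a family of probabilities over a time parameter, a pair of
numbers of visits, and a parameter in a finite type. -/
lemma tsum_ne_top_of_le {I : Type*} [Finite I] {p : ℕ × ℕ × ℕ × I → ℝ≥0∞} {a : ℕ → ℝ} {C q : ℝ}
    (hC : 0 ≤ C) (ha0 : ∀ j, 0 ≤ a j) (ha : Summable a) (hq0 : 0 ≤ q) (hq1 : q < 1)
    (h : ∀ j k l i, p (j, k, l, i) ≤ ENNReal.ofReal (C * a j * q ^ (k + l))) :
    ∑' t, p t ≠ ∞ := by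
  have hg := summable_geometric_of_lt_one hq0 hq1
  have h1 : Summable fun t : ℕ × I => q ^ t.1 * (1 : ℝ) :=
    Summable.mul_of_nonneg hg (Summable.of_finite (f := fun _ : I => (1 : ℝ)))
      (fun _ => by positivity) (fun _ => by positivity)
  have h2 := Summable.mul_of_nonneg hg h1 (fun _ => by positivity) (fun _ => by positivity)
  have h3 := Summable.mul_of_nonneg (ha.mul_left C) h2
    (fun j => mul_nonneg hC (ha0 j)) (fun _ => by positivity)
  refine ne_top_of_le_ne_top h3.tsum_ofReal_ne_top (ENNReal.tsum_le_tsum ?_)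
  rintro ⟨j, k, l, i⟩
  refine (h j k l i).trans (le_of_eq ?_)
  congr 1
  ring

section UpperBound

variable {d : ℕ}

/-- Numbers of visits to two neighbours, counted from the first visit to one of them. -/
lemma exists_first_pair_visit {x : ℕ → Lattice d} {z u : Lattice d} {n : ℕ} (hu : u ≠ 0)
    (h : visits x z n ≠ 0 ∨ visits x (z + u) n ≠ 0) :
    ∃ j m, 1 ≤ j ∧ n = j + m ∧
      ((visits x z n = visits (shift j x) 0 m + 1 ∧
          visits x (z + u) n = visits (shift j x) u m) ∨
        (visits x (z + u) n = visits (shift j x) 0 m + 1 ∧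
          visits x z n = visits (shift j x) (-u) m)) := by
  classical
  have hex : ∃ s, 0 < s ∧ s ≤ n ∧ (pos x s = z ∨ pos x s = z + u) := by
    by_contra hcon
    push Not at hcon
    rcases h with h | h
    · exact h ((visits_eq_zero_iff _ _ _).2 fun s hs hsn => (hcon s hs hsn).1)
    · exact h ((visits_eq_zero_iff _ _ _).2 fun s hs hsn => (hcon s hs hsn).2)
  obtain ⟨hj0, hjn, hj⟩ := Nat.find_spec hex
  have hmin : ∀ r, 0 < r → r < Nat.find hex → pos x r ≠ z ∧ pos x r ≠ z + u := by
    intro r hr hlt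
    have := Nat.find_min hex hlt
    push Not at this
    exact this hr (by omega)
  generalize Nat.find hex = j at *
  obtain ⟨m, rfl⟩ := Nat.exists_eq_add_of_le hjn
  obtain ⟨i, rfl⟩ := Nat.exists_eq_succ_of_ne_zero hj0.ne'
  have hz : visits x z i = 0 := (visits_eq_zero_iff _ _ _).2 fun s hs hsi =>
    (hmin s hs (Nat.lt_succ_of_le hsi)).1
  have hzu : visits x (z + u) i = 0 := (visits_eq_zero_iff _ _ _).2 fun s hs hsi =>
    (hmin s hs (Nat.lt_succ_of_le hsi)).2
  refine ⟨i + 1, m, by omega, rfl, ?_⟩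
  simp only [Nat.succ_eq_add_one] at *
  rcases hj with hj | hj
  · left
    rw [visits_add x _ (i + 1), visits_add x _ (i + 1), visits_succ, visits_succ, hj, hz, hzu]
    simp [hu, add_comm]
  · right
    rw [visits_add x _ (i + 1), visits_add x _ (i + 1), visits_succ, visits_succ, hj, hz, hzu]
    simp [hu, add_comm]

variable [NeZero d]

/-- Almost surely, the numbers of visits to any two neighbours up to time `n` are eventually in the
region `(1 + ε) log n • 𝓑`. -/
theorem ae_eventually_rate_visits_le (hd : 4 ≤ d) {ε : ℝ} (hε : 0 < ε) :
    ∀ᵐ x ∂pathLaw d, ∃ n₀ : ℕ, ∀ n : ℕ, n₀ ≤ n → ∀ (z : Lattice d) (i : Fin d ⊕ Fin d),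
      rate (pairProb d) (visits x z n) (visits x (z + unitVec i) n) ≤ (1 + ε) * Real.log n := by
  classical
  set α := pairProb d with hα
  have hα0 : 0 < α := pairProb_pos
  have hα1 : 2 * α < 1 := two_mul_pairProb_lt_one hd
  set c₀ := -Real.log (2 * α) with hc₀
  have hc₀0 : 0 < c₀ := by
    have := Real.log_neg (by positivity) hα1
    linarith
  -- The fraction `1 - δ` of the rate still gives the summable power `j ^ (-(1 + ε / 2))`; the
  -- fraction `δ` pays for the sum over `k` and `l`.
  set δ := ε / (2 * (1 + ε)) with hδ
  have hδ0 : 0 < δ := by positivity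
  have hδ1 : (1 + ε) * (1 - δ) = 1 + ε / 2 := by rw [hδ]; field_simp; ring
  have hδ2 : 0 < 1 - δ := by
    by_contra hcon
    have := mul_nonpos_of_nonneg_of_nonpos (by positivity : 0 ≤ 1 + ε) (not_lt.1 hcon)
    linarith
  -- The threshold involves the time `j` of the first visit to the pair, not the final time; the
  -- rate is taken at `k + 1` because the visit at time `j` counts too.
  let E : ℕ × ℕ × ℕ × (Fin d ⊕ Fin d) → Set (ℕ → Lattice d) := fun t =>
    if 1 ≤ t.1 ∧ (1 + ε) * Real.log t.1 < rate α ((t.2.1 + 1 : ℕ) : ℝ) t.2.2.1 then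
      shift t.1 ⁻¹' reachEvent t.2.1 t.2.2.1 (unitVec t.2.2.2) else ∅
  have hsum : ∑' t, pathLaw d (E t) ≠ ∞ := by
    refine tsum_ne_top_of_le (a := fun j : ℕ => (j : ℝ) ^ (-(1 + ε / 2))) (C := α⁻¹)
      (q := Real.exp (-(δ * c₀))) (by positivity) (fun j => by positivity)
      (Real.summable_nat_rpow.2 (by linarith)) (Real.exp_nonneg _)
      (Real.exp_lt_one_iff.2 (by have := mul_pos hδ0 hc₀0; linarith)) ?_
    intro j k l i
    simp only [E]
    split_ifs with hcond
    · obtain ⟨hj, hrate⟩ := hcond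
      rw [(measurePreserving_shift j).measure_preimage
        (measurableSet_reachEvent _ _ _).nullMeasurableSet, ← ENNReal.ofReal_toReal
        (measure_ne_top (pathLaw d) _), ← measureReal_def]
      refine ENNReal.ofReal_le_ofReal ((pathLaw_reachEvent_le hd k l i).trans ?_)
      refine (wordWeight_le_succ hα0 k l).trans ?_
      rw [mul_assoc]
      refine mul_le_mul_of_nonneg_left ?_ (by positivity)
      refine (wordWeight_le_exp_neg_rate hα0 (k + 1) l).trans ?_
      have hj0 : (0 : ℝ) < j := by exact_mod_cast hj
      rw [Real.rpow_def_of_pos hj0, ← Real.exp_nat_mul, ← Real.exp_add, Real.exp_le_exp]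
      have h1 := mul_add_le_rate (x := ((k + 1 : ℕ) : ℝ)) (y := l) hα0 (by positivity)
        (by positivity)
      have h2 : (1 + ε / 2) * Real.log j ≤ (1 - δ) * rate α ((k + 1 : ℕ) : ℝ) l := by
        rw [← hδ1]
        calc (1 + ε) * (1 - δ) * Real.log j = (1 - δ) * ((1 + ε) * Real.log j) := by ring
          _ ≤ _ := by gcongr
      have h3 : δ * (c₀ * ((k : ℝ) + l)) ≤ δ * rate α ((k + 1 : ℕ) : ℝ) l := by
        gcongr
        refine le_trans ?_ h1
        gcongr
        linarith
      push_cast at *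
      linarith
    · simp
  filter_upwards [ae_finite_setOfPred_mem hsum] with x hx
  -- The finitely many exceptional counts have bounded rate, which `(1 + ε) log n` eventually
  -- exceeds.
  obtain ⟨M, hM⟩ := (hx.image fun t => rate α ((t.2.1 + 1 : ℕ) : ℝ) t.2.2.1).bddAbove
  have hlog : ∀ᶠ n : ℕ in Filter.atTop, max M 0 / (1 + ε) ≤ Real.log n :=
    (Real.tendsto_log_atTop.comp tendsto_natCast_atTop_atTop).eventually_ge_atTop _
  obtain ⟨n₀, hn₀⟩ := Filter.eventually_atTop.1 hlog
  refine ⟨n₀, fun n hn z i => ?_⟩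
  have hlogn := hn₀ n hn
  rw [div_le_iff₀ (by positivity), mul_comm] at hlogn
  have key : ∀ (j m k l : ℕ) (i : Fin d ⊕ Fin d), 1 ≤ j → n = j + m →
      k = visits (shift j x) 0 m → l = visits (shift j x) (unitVec i) m →
      rate α ((k + 1 : ℕ) : ℝ) l ≤ (1 + ε) * Real.log n := by
    intro j m k l i hj hjm hk hl
    by_cases hcond : (1 + ε) * Real.log j < rate α ((k + 1 : ℕ) : ℝ) l
    · have hmem : (j, k, l, i) ∈ {t | x ∈ E t} := by
        change x ∈ E (j, k, l, i)
        simp only [E]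
        rw [if_pos ⟨hj, hcond⟩]
        exact ⟨m, hk.symm, hl.symm⟩
      have := hM ⟨_, hmem, rfl⟩
      exact (this.trans (le_max_left _ _)).trans hlogn
    · refine (not_lt.1 hcond).trans ?_
      have hj0 : (0 : ℝ) < j := by exact_mod_cast hj
      gcongr
      omega
  by_cases h : visits x z n ≠ 0 ∨ visits x (z + unitVec i) n ≠ 0
  · obtain ⟨j, m, hj, hjm, ⟨h1, h2⟩ | ⟨h1, h2⟩⟩ := exists_first_pair_visit (unitVec_ne_zero i) h
    · rw [h1]
      exact key j m _ _ i hj hjm rfl h2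
    · rw [h1, rate_comm]
      rw [← unitVec_swap] at h2
      exact key j m _ _ i.swap hj hjm rfl h2
  · push Not at h
    rw [h.1, h.2, Nat.cast_zero, rate_zero_zero]
    exact (le_max_right _ _).trans hlogn

end UpperBound

/-! ### A second moment inequality -/

/-- A second moment bound for the probability that none of the events `Y b` occurs, when each of
them is most of an event `S b` and the events `S b` are pairwise independent. -/
lemma measureReal_iInter_compl_le {Ω : Type*} [MeasurableSpace Ω] {μ : Measure Ω}
    [IsProbabilityMeasure μ] {K : ℕ} {S Y : ℕ → Set Ω} {p θ : ℝ} (hK : 0 < K) (hp : 0 < p)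
    (hY : ∀ b, MeasurableSet (Y b)) (hYS : ∀ b, Y b ⊆ S b)
    (hSp : ∀ b, μ.real (S b) = p) (hSS : ∀ b c, b < c → μ.real (S b ∩ S c) = p ^ 2)
    (hSY : ∀ b, μ.real (S b \ Y b) ≤ θ) :
    μ.real {ω | ∀ b < K, ω ∉ Y b} ≤ 1 / (K * p) + 2 * θ / p := by
  set Z : Ω → ℝ := fun ω => ∑ b ∈ Finset.range K, (Y b).indicator 1 ω with hZ
  have hK0 : (0 : ℝ) < K := by exact_mod_cast hK
  have hint : ∀ A : Set Ω, MeasurableSet A → Integrable (A.indicator (1 : Ω → ℝ)) μ :=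
    fun A hA => (integrable_const (1 : ℝ)).indicator hA
  have hZint : Integrable Z μ := integrable_finsetSum _ fun b _ => hint _ (hY b)
  have hZsq : ∀ ω, Z ω ^ 2 = ∑ b ∈ Finset.range K, ∑ c ∈ Finset.range K,
      (Y b ∩ Y c).indicator 1 ω := by
    intro ω
    rw [hZ, sq, Finset.sum_mul_sum]
    refine Finset.sum_congr rfl fun b _ => Finset.sum_congr rfl fun c _ => ?_
    rw [Set.inter_indicator_one]
    rfl
  have hZsqint : Integrable (fun ω => Z ω ^ 2) μ := by
    simp_rw [hZsq]
    exact integrable_finsetSum _ fun b _ => integrable_finsetSum _ fun c _ =>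
      hint _ ((hY b).inter (hY c))
  have hEZ : K * (p - θ) ≤ ∫ ω, Z ω ∂μ := by
    rw [hZ, integral_finsetSum _ fun b _ => hint _ (hY b)]
    have hb : ∀ b ∈ Finset.range K, p - θ ≤ ∫ ω, (Y b).indicator (1 : Ω → ℝ) ω ∂μ := by
      intro b _
      rw [integral_indicator_one (hY b)]
      have h1 := measureReal_sdiff_add_inter (μ := μ) (s := S b) (hY b)
      rw [Set.inter_eq_self_of_subset_right (hYS b), hSp] at h1
      linarith [hSY b]
    have := Finset.card_nsmul_le_sum _ _ _ hb
    simpa using this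
  have hEZsq : ∫ ω, Z ω ^ 2 ∂μ ≤ K * p + K ^ 2 * p ^ 2 := by
    simp_rw [hZsq]
    rw [integral_finsetSum _ fun b _ => integrable_finsetSum _ fun c _ =>
      hint _ ((hY b).inter (hY c))]
    have hb : ∀ b ∈ Finset.range K, ∫ ω, ∑ c ∈ Finset.range K,
        (Y b ∩ Y c).indicator (1 : Ω → ℝ) ω ∂μ ≤ p + K * p ^ 2 := by
      intro b hb
      rw [integral_finsetSum _ fun c _ => hint _ ((hY b).inter (hY c))]
      have hc : ∀ c ∈ Finset.range K, ∫ ω, (Y b ∩ Y c).indicator (1 : Ω → ℝ) ω ∂μ ≤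
          (if c = b then p else 0) + p ^ 2 := by
        intro c _
        rw [integral_indicator_one ((hY b).inter (hY c))]
        have hle : μ.real (Y b ∩ Y c) ≤ μ.real (S b ∩ S c) :=
          measureReal_mono (Set.inter_subset_inter (hYS b) (hYS c))
        rcases lt_trichotomy b c with h | h | h
        · rw [if_neg h.ne', zero_add, ← hSS b c h]; exact hle
        · subst h
          rw [Set.inter_self, Set.inter_self, hSp] at hle
          rw [Set.inter_self, if_pos rfl]
          linarith [sq_nonneg p]
        · rw [if_neg h.ne, zero_add, ← hSS c b h, Set.inter_comm (S c)]; exact hle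
      refine (Finset.sum_le_sum hc).trans (le_of_eq ?_)
      rw [Finset.sum_add_distrib, Finset.sum_ite_eq' , if_pos hb]
      simp
    refine (Finset.sum_le_card_nsmul _ _ _ hb).trans (le_of_eq ?_)
    simp only [Finset.card_range, nsmul_eq_mul]
    ring
  set B : Set Ω := {ω | ∀ b < K, ω ∉ Y b} with hB
  have hBm : MeasurableSet B := by
    have : B = ⋂ b, ⋂ _ : b < K, (Y b)ᶜ := by ext ω; simp [hB]
    rw [this]
    exact MeasurableSet.iInter fun b => MeasurableSet.iInter fun _ => (hY b).compl
  -- Chebyshev's inequality, centred at the mean `K p` of the count for the `S b`: on `B` the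
  -- variable `Z` vanishes.
  have hmain : (K * p) ^ 2 * μ.real B ≤ ∫ ω, (Z ω - K * p) ^ 2 ∂μ := by
    rw [← integral_indicator_one hBm, ← integral_const_mul]
    refine integral_mono ((hint _ hBm).const_mul _) ?_ fun ω => ?_
    · have : (fun ω => (Z ω - K * p) ^ 2) = fun ω => Z ω ^ 2 - 2 * (K * p) * Z ω + (K * p) ^ 2 := by
        funext ω; ring
      rw [this]
      exact (hZsqint.sub (hZint.const_mul _)).add (integrable_const _)
    · by_cases hω : ω ∈ B
      · have : Z ω = 0 := Finset.sum_eq_zero fun b hb =>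
          Set.indicator_of_notMem (hω b (Finset.mem_range.1 hb)) _
        simp [this, hω]
      · simp only [Set.indicator_of_notMem hω, mul_zero]
        positivity
  have hexp : ∫ ω, (Z ω - K * p) ^ 2 ∂μ =
      ∫ ω, Z ω ^ 2 ∂μ - 2 * (K * p) * ∫ ω, Z ω ∂μ + (K * p) ^ 2 := by
    have : (fun ω => (Z ω - K * p) ^ 2) = fun ω => Z ω ^ 2 - 2 * (K * p) * Z ω + (K * p) ^ 2 := by
      funext ω; ring
    have h1 : Integrable (fun ω => Z ω ^ 2 - 2 * (K * p) * Z ω) μ :=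
      hZsqint.sub (hZint.const_mul _)
    rw [this, integral_add h1 (integrable_const _),
      integral_sub hZsqint (hZint.const_mul _), integral_const_mul]
    simp
  have hbound : (K * p) ^ 2 * μ.real B ≤ K * p + 2 * K ^ 2 * p * θ := by
    have h1 := mul_le_mul_of_nonneg_left hEZ (by positivity : 0 ≤ 2 * (K * p))
    nlinarith
  have hfin : 1 / (K * p) + 2 * θ / p = (K * p + 2 * K ^ 2 * p * θ) / (K * p) ^ 2 := by
    field_simp
  rw [hfin, le_div_iff₀ (by positivity), mul_comm]
  exact hbound

/-! ### Time reversal and late visits -/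

section Past

variable {d : ℕ}

/-- The event that the walk does not visit `S_m` or `S_m + u` before the time `m`. -/
def pastAvoid (m : ℕ) (u : Lattice d) : Set (ℕ → Lattice d) :=
  {x | ∀ s < m, pos x s ≠ pos x m ∧ pos x s ≠ pos x m + u}

/-- The event that the walk visits `S_m` or `S_m + u` at a time not later than `m - g`. -/
def pastHit (m g : ℕ) (u : Lattice d) : Set (ℕ → Lattice d) :=
  {x | ∃ s, s + g ≤ m ∧ (pos x s = pos x m ∨ pos x s = pos x m + u)}

lemma determinedBefore_pastAvoid (m : ℕ) (u : Lattice d) : DeterminedBefore m (pastAvoid m u) := by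
  intro x y hxy hx s hs
  rw [← pos_congr hxy hs.le, ← pos_congr hxy le_rfl]
  exact hx s hs

lemma determinedBefore_pastHit (m g : ℕ) (u : Lattice d) :
    DeterminedBefore m (pastHit m g u) := by
  rintro x y hxy ⟨s, hs, hx⟩
  refine ⟨s, hs, ?_⟩
  rw [← pos_congr hxy (by omega : s ≤ m), ← pos_congr hxy le_rfl]
  exact hx

/-- Reversal of the times before `m`. -/
def reverseTime (m k : ℕ) : ℕ := if k < m then m - 1 - k else k

lemma reverseTime_injective (m : ℕ) : Function.Injective (reverseTime m) := by
  intro a b h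
  unfold reverseTime at h
  split_ifs at h <;> omega

lemma pos_reverse (x : ℕ → Lattice d) {m r : ℕ} (hr : r ≤ m) :
    pos (fun k => x (reverseTime m k)) r = pos x m - pos x (m - r) := by
  induction r with
  | zero => simp
  | succ r ih =>
    have h : m - r = (m - (r + 1)) + 1 := by omega
    rw [pos_succ, ih (by omega), h, pos_succ]
    have h2 : reverseTime m r = m - (r + 1) := by unfold reverseTime; split_ifs <;> omega
    rw [h2]
    abel

/-- In the reversed walk the past site `S_s` sits at `S_m - S_s`, so a past visit to `S_m + u`
becomes a visit to `-u`. -/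
lemma reverse_preimage_avoidEvent_subset (m : ℕ) (u : Lattice d) :
    (fun (x : ℕ → Lattice d) k => x (reverseTime m k)) ⁻¹' avoidEvent (-u) ⊆ pastAvoid m u := by
  intro x hx s hs
  have h := hx (m - s) (by omega)
  rw [pos_reverse x (by omega : m - s ≤ m), show m - (m - s) = s by omega] at h
  refine ⟨fun h1 => h.1 (by rw [h1, sub_self]), fun h1 => h.2 (by rw [h1]; abel)⟩

lemma pastHit_subset_reverse_preimage (m g : ℕ) (u : Lattice d) :
    pastHit m g u ⊆ (fun (x : ℕ → Lattice d) k => x (reverseTime m k)) ⁻¹'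
      ({x | ∃ s, g ≤ s ∧ pos x s = 0} ∪ {x | ∃ s, g ≤ s ∧ pos x s = -u}) := by
  rintro x ⟨s, hs, hx⟩
  have h := pos_reverse x (by omega : m - s ≤ m)
  rw [show m - (m - s) = s by omega] at h
  rcases hx with hx | hx
  · exact Or.inl ⟨m - s, by omega, by rw [h, hx, sub_self]⟩
  · exact Or.inr ⟨m - s, by omega, by rw [h, hx]; abel⟩

lemma measurableSet_late_visit (g : ℕ) (v : Lattice d) :
    MeasurableSet {x | ∃ s, g ≤ s ∧ pos x s = v} := by
  have : {x : ℕ → Lattice d | ∃ s, g ≤ s ∧ pos x s = v} =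
      ⋃ s : ℕ, ⋃ _ : g ≤ s, {x | pos x s = v} := by
    ext x; simp
  rw [this]
  exact MeasurableSet.iUnion fun n => MeasurableSet.iUnion fun _ => measurableSet_pos_eq n _

variable [NeZero d]

lemma le_pathLaw_pastAvoid (hd : 4 ≤ d) (m : ℕ) (i : Fin d ⊕ Fin d) :
    1 - 2 * pairProb d ≤ (pathLaw d).real (pastAvoid m (unitVec i)) := by
  rw [← pathLaw_avoidEvent hd i.swap, unitVec_swap,
    ← (measurePreserving_reindex (reverseTime_injective m)).measureReal_preimage
      (measurableSet_avoidEvent _).nullMeasurableSet]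
  exact measureReal_mono (reverse_preimage_avoidEvent_subset m _)

lemma pathLaw_pastHit_le {ρ : ℝ≥0∞} {g : ℕ}
    (hρ : ∀ v : Lattice d, pathLaw d {x | ∃ s, g ≤ s ∧ pos x s = v} ≤ ρ) (m : ℕ)
    (u : Lattice d) : pathLaw d (pastHit m g u) ≤ 2 * ρ := by
  refine (measure_mono (pastHit_subset_reverse_preimage m g u)).trans ?_
  rw [(measurePreserving_reindex (reverseTime_injective m)).measure_preimage
    ((measurableSet_late_visit _ _).union (measurableSet_late_visit _ _)).nullMeasurableSet, two_mul]
  exact (measure_union_le _ _).trans (add_le_add (hρ _) (hρ _))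

/-- Conditioning on the position at time `m` leaves a late visit to a site depending on that
position; uniformity of the bound in the site is essential. -/
lemma pathLaw_inter_late_visit_le {ρ : ℝ≥0∞} {m g : ℕ}
    (hρ : ∀ v : Lattice d, pathLaw d {x | ∃ s, g ≤ s ∧ pos x s = v} ≤ ρ)
    {A : Set (ℕ → Lattice d)} (hA : DeterminedBefore m A) (v : Lattice d) :
    pathLaw d (A ∩ {x | ∃ s, m + g ≤ s ∧ pos x s = v}) ≤ pathLaw d A * ρ := by
  have hAw : ∀ w, DeterminedBefore m (A ∩ {x | pos x m = w}) :=
    fun w => hA.inter (determinedBefore_pos_eq le_rfl w)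
  have hsub : A ∩ {x | ∃ s, m + g ≤ s ∧ pos x s = v} ⊆
      ⋃ w : Lattice d, ((A ∩ {x | pos x m = w}) ∩
        shift m ⁻¹' {x | ∃ s, g ≤ s ∧ pos x s = v - w}) := by
    rintro x ⟨hxA, s, hs, hx⟩
    obtain ⟨r, rfl⟩ := Nat.exists_eq_add_of_le ((Nat.le_add_right m g).trans hs)
    refine Set.mem_iUnion.2 ⟨pos x m, ⟨hxA, rfl⟩, r, by omega, ?_⟩
    rw [← hx, pos_add]; abel
  have hAU : pathLaw d A = ∑' w : Lattice d, pathLaw d (A ∩ {x | pos x m = w}) := by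
    rw [← measure_iUnion _ fun w => (hAw w).measurableSet]
    · congr 1
      ext x; simp
    · intro w w' hw
      refine Set.disjoint_left.2 fun x hx hx' => hw ?_
      rw [← show pos x m = w from hx.2, ← show pos x m = w' from hx'.2]
  refine (measure_mono hsub).trans ((measure_iUnion_le _).trans ?_)
  rw [hAU, ← ENNReal.tsum_mul_right]
  refine ENNReal.tsum_le_tsum fun w => ?_
  rw [pathLaw_inter_shift (hAw w) (measurableSet_late_visit _ _)]
  gcongr
  exact hρ _

end Past

/-! ### Blocks and local success -/

section Blocks

variable {d : ℕ}

/-- The event that between the times `T` and `L` the walk has made `k` visits to `0` and `l` visits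
to `u`. -/
def windowEvent (k l : ℕ) (u : Lattice d) (T L : ℕ) : Set (ℕ → Lattice d) :=
  {x | ∀ r, T ≤ r → r ≤ L → visits x 0 r = k ∧ visits x u r = l}

/-- The event that, within the `b`-th block of `2 * L` steps, the site at the middle of the block
is new and collects the prescribed numbers of visits, for itself and for its neighbour. -/
def blockEvent (k l : ℕ) (u : Lattice d) (T L b : ℕ) : Set (ℕ → Lattice d) :=
  shift (2 * L * b) ⁻¹' (pastAvoid L u ∩ shift L ⁻¹' windowEvent k l u T L)

/-- The event that the site at the middle of the `b`-th block of `2 * L` steps has not been seen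
before and collects the prescribed numbers of visits, for itself and for its neighbour, among all
later times. -/
def globalBlockEvent (k l : ℕ) (u : Lattice d) (T L b : ℕ) : Set (ℕ → Lattice d) :=
  pastAvoid (2 * L * b + L) u ∩ shift (2 * L * b + L) ⁻¹' stableEvent k l u T

lemma determinedBefore_windowEvent (k l : ℕ) (u : Lattice d) (T L : ℕ) :
    DeterminedBefore L (windowEvent k l u T L) := by
  intro x y hxy hx r hT hL
  rw [← visits_congr hxy hL, ← visits_congr hxy hL]
  exact hx r hT hL

lemma determinedBefore_middle (k l : ℕ) (u : Lattice d) (T L : ℕ) :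
    DeterminedBefore (2 * L) (pastAvoid L u ∩ shift L ⁻¹' windowEvent k l u T L) := by
  have h := (determinedBefore_windowEvent k l u T L).shift (m := L)
  rw [← two_mul] at h
  exact ((determinedBefore_pastAvoid L u).mono (by omega)).inter h

lemma determinedBefore_blockEvent (k l : ℕ) (u : Lattice d) (T L b : ℕ) :
    DeterminedBefore (2 * L * (b + 1)) (blockEvent k l u T L b) :=
  (determinedBefore_middle k l u T L).shift

lemma measurableSet_globalBlockEvent (k l : ℕ) (u : Lattice d) (T L b : ℕ) :
    MeasurableSet (globalBlockEvent k l u T L b) :=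
  (determinedBefore_pastAvoid _ u).measurableSet.inter
    (measurable_shift _ (measurableSet_stableEvent k l u T))

lemma globalBlockEvent_subset (k l : ℕ) (u : Lattice d) (T L b : ℕ) :
    globalBlockEvent k l u T L b ⊆ blockEvent k l u T L b := by
  rintro x ⟨h1, h2⟩
  refine ⟨fun s hs => ?_, fun r hT _ => ?_⟩
  · have h := h1 (2 * L * b + s) (by omega)
    rw [pos_add, pos_add, add_assoc] at h
    exact ⟨fun h3 => h.1 (by rw [h3]), fun h3 => h.2 (by rw [h3])⟩
  · rw [shift_shift]
    exact h2 r hT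

/-- Local success controls all times within `L` of the middle, so only a visit at distance at least
`L`, past or future, can spoil it. The counts at time `T` are kept in each piece, so that their
small probability survives as a factor. -/
lemma blockEvent_diff_subset (k l : ℕ) (u : Lattice d) {T L : ℕ} (hTL : T ≤ L) (b : ℕ) :
    blockEvent k l u T L b \ globalBlockEvent k l u T L b ⊆
      (pastHit (2 * L * b + L) L u ∩
        shift (2 * L * b + L) ⁻¹' {x | visits x 0 T = k ∧ visits x u T = l}) ∪
      (shift (2 * L * b + L) ⁻¹'
        (({x | visits x 0 T = k ∧ visits x u T = l} ∩ {x | ∃ s, L ≤ s ∧ pos x s = 0}) ∪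
        ({x | visits x 0 T = k ∧ visits x u T = l} ∩ {x | ∃ s, L ≤ s ∧ pos x s = u}))) := by
  rintro x ⟨⟨h1, h2⟩, h3⟩
  have h2' : shift (2 * L * b + L) x ∈ windowEvent k l u T L := by
    rw [← shift_shift]; exact h2
  have hT : shift (2 * L * b + L) x ∈ {x | visits x 0 T = k ∧ visits x u T = l} :=
    h2' T le_rfl hTL
  by_cases hpast : x ∈ pastAvoid (2 * L * b + L) u
  · right
    have hst : shift (2 * L * b + L) x ∉ stableEvent k l u T := fun h => h3 ⟨hpast, h⟩
    set y := shift (2 * L * b + L) x with hy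
    by_cases hvis : ∃ s, L ≤ s ∧ (pos y s = 0 ∨ pos y s = u)
    · obtain ⟨s, hs, h | h⟩ := hvis
      · exact Or.inl ⟨hT, s, hs, h⟩
      · exact Or.inr ⟨hT, s, hs, h⟩
    · push Not at hvis
      refine absurd (fun r hr => ?_) hst
      rcases le_total r L with hrL | hrL
      · exact h2' r hr hrL
      · obtain ⟨m, rfl⟩ := Nat.exists_eq_add_of_le hrL
        have hz : ∀ z : Lattice d, (z = 0 ∨ z = u) →
            visits (shift L y) (z - pos y L) m = 0 := by
          intro z hz
          rw [visits_eq_zero_iff]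
          intro s _ _ hs
          have h := hvis (L + s) (by omega)
          rw [pos_add, hs, add_sub_cancel] at h
          rcases hz with rfl | rfl
          · exact h.1 rfl
          · exact h.2 rfl
        rw [visits_add, visits_add, hz 0 (Or.inl rfl), hz u (Or.inr rfl)]
        exact h2' L hTL le_rfl
  · left
    refine ⟨?_, hT⟩
    simp only [pastAvoid, Set.mem_ofPred_eq] at hpast
    push Not at hpast
    obtain ⟨s, hs, h⟩ := hpast
    have h' : pos x s = pos x (2 * L * b + L) ∨ pos x s = pos x (2 * L * b + L) + u := by
      by_cases h0 : pos x s = pos x (2 * L * b + L)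
      · exact Or.inl h0
      · exact Or.inr (h h0)
    refine ⟨s, ?_, h'⟩
    by_contra hcon
    obtain ⟨r, rfl⟩ := Nat.exists_eq_add_of_le (by omega : 2 * L * b ≤ s)
    have h4 := h1 r (by omega)
    rw [pos_add, pos_add, add_assoc] at h'
    rcases h' with h' | h'
    · exact h4.1 (add_left_cancel h')
    · exact h4.2 (add_left_cancel h')

/-- The extra visit in `k + 1` is the arrival at the middle of the block. -/
lemma visits_of_mem_globalBlockEvent {k l : ℕ} {u : Lattice d} (hu : u ≠ 0) {T L b n : ℕ}
    (hL : 0 < L) {x : ℕ → Lattice d} (hx : x ∈ globalBlockEvent k l u T L b)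
    (hn : 2 * L * b + L + T ≤ n) :
    visits x (pos x (2 * L * b + L)) n = k + 1 ∧
      visits x (pos x (2 * L * b + L) + u) n = l := by
  obtain ⟨h1, h2⟩ := hx
  generalize hm : 2 * L * b + L = m at *
  obtain ⟨r, rfl⟩ := Nat.exists_eq_add_of_le ((Nat.le_add_right m T).trans hn)
  obtain ⟨i, rfl⟩ := Nat.exists_eq_succ_of_ne_zero (by omega : m ≠ 0)
  rw [Nat.succ_eq_add_one] at *
  have hz : visits x (pos x (i + 1)) i = 0 := (visits_eq_zero_iff _ _ _).2 fun s _ hs =>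
    (h1 s (by omega)).1
  have hzu : visits x (pos x (i + 1) + u) i = 0 := (visits_eq_zero_iff _ _ _).2 fun s _ hs =>
    (h1 s (by omega)).2
  obtain ⟨h3, h4⟩ := h2 r (by omega)
  rw [visits_add x _ (i + 1), visits_add x _ (i + 1), visits_succ, visits_succ, hz, hzu]
  simp [hu, h3, h4, add_comm]

variable [NeZero d]

lemma pathLaw_real_inter_shift {m : ℕ} {A B : Set (ℕ → Lattice d)} (hA : DeterminedBefore m A)
    (hB : MeasurableSet B) :
    (pathLaw d).real (A ∩ shift m ⁻¹' B) = (pathLaw d).real A * (pathLaw d).real B := by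
  simp only [measureReal_def]
  rw [pathLaw_inter_shift hA hB, ENNReal.toReal_mul]

/-- The probability that no block produces a pair of neighbours with given local times. -/
theorem exists_pathLaw_no_block_le (hd : 4 ≤ d) :
    ∃ C : ℝ, 0 < C ∧ ∀ {β : ℝ} {t : ℕ}, 0 < β →
    (∀ (i : Fin d ⊕ Fin d) (z : Lattice d), (z = 0 ∨ z = unitVec i) →
      β ≤ (pathLaw d).real (⋃ s : Fin (t + 1), firstVisit (unitVec i) z s)) →
    ∀ (k l L K : ℕ) (i : Fin d ⊕ Fin d), 0 < K → 0 < L → 2 * ((k + l) * t) ≤ L →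
      (pathLaw d).real {x | ∀ b < K, x ∉ globalBlockEvent k l (unitVec i) ((k + l) * t) L b} ≤
        C * (1 / (K * wordWeight β k l) +
          wordWeight (pairProb d) k l / (L * wordWeight β k l)) := by
  obtain ⟨C, hC, hlate⟩ := exists_pathLaw_late_visit_le hd
  have hα := two_mul_pairProb_lt_one hd
  have hα0 := pairProb_pos (d := d)
  set e := 1 - 2 * pairProb d with he
  have he0 : 0 < e := by linarith
  refine ⟨max (1 / e ^ 2) (16 * C / e ^ 2), by positivity, ?_⟩
  intro β t hβ ht k l L K i hK hL hT
  set T := (k + l) * t with hTdef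
  set u : Lattice d := unitVec i with hu
  have hwβ : 0 < wordWeight β k l := by
    have : 0 < (k + l).choose k := Nat.choose_pos (by omega)
    unfold wordWeight
    positivity
  have hwα : 0 ≤ wordWeight (pairProb d) k l := by unfold wordWeight; positivity
  have hL0 : (0 : ℝ) < L := by exact_mod_cast hL
  have hK0 : (0 : ℝ) < K := by exact_mod_cast hK
  set V : Set (ℕ → Lattice d) := {x | visits x 0 T = k ∧ visits x u T = l} with hV
  have hVdet : DeterminedBefore T V := determinedBefore_visits_pair k l T u
  set ρ := ENNReal.ofReal (2 * C / L) with hρdef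
  -- Used for the gaps `L` and `L - T`; the latter is at least `L / 2` because `2 T ≤ L`.
  have hρ : ∀ g : ℕ, L ≤ 2 * g → ∀ v : Lattice d,
      pathLaw d {x | ∃ s, g ≤ s ∧ pos x s = v} ≤ ρ := by
    intro g hg v
    refine (hlate g (by omega) v).trans (ENNReal.ofReal_le_ofReal ?_)
    have hg0 : (0 : ℝ) < g := by exact_mod_cast (by omega : 0 < g)
    have hg1 : (L : ℝ) ≤ 2 * g := by exact_mod_cast hg
    rw [div_le_div_iff₀ hg0 hL0]
    nlinarith
  set p := (pathLaw d).real (pastAvoid L u) * (pathLaw d).real (windowEvent k l u T L) with hp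
  have hS0 : (pathLaw d).real (pastAvoid L u ∩ shift L ⁻¹' windowEvent k l u T L) = p :=
    pathLaw_real_inter_shift (determinedBefore_pastAvoid L u)
      (determinedBefore_windowEvent k l u T L).measurableSet
  have hSp : ∀ b, (pathLaw d).real (blockEvent k l u T L b) = p := by
    intro b
    rw [← hS0]
    exact (measurePreserving_shift _).measureReal_preimage
      (determinedBefore_middle k l u T L).measurableSet.nullMeasurableSet
  have hple : e ^ 2 * wordWeight β k l ≤ p := by
    have h1 := le_pathLaw_pastAvoid hd L i
    have h2 := le_pathLaw_stableEvent hd hβ.le ht k l i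
    have h3 : (pathLaw d).real (stableEvent k l u T) ≤
        (pathLaw d).real (windowEvent k l u T L) :=
      measureReal_mono fun x hx r hr _ => hx r hr
    calc e ^ 2 * wordWeight β k l = e * (wordWeight β k l * e) := by ring
      _ ≤ p := mul_le_mul h1 (h2.trans h3) (by positivity) measureReal_nonneg
  have hp0 : 0 < p := lt_of_lt_of_le (by positivity) hple
  -- Distinct blocks use disjoint sets of steps.
  have hSS : ∀ b c, b < c →
      (pathLaw d).real (blockEvent k l u T L b ∩ blockEvent k l u T L c) = p ^ 2 := by
    intro b c hbc
    have hdet : DeterminedBefore (2 * L * c) (blockEvent k l u T L b) :=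
      (determinedBefore_blockEvent k l u T L b).mono (Nat.mul_le_mul_left _ hbc)
    rw [show blockEvent k l u T L c = shift (2 * L * c) ⁻¹'
      (pastAvoid L u ∩ shift L ⁻¹' windowEvent k l u T L) from rfl,
      pathLaw_real_inter_shift hdet (determinedBefore_middle k l u T L).measurableSet, hSp, hS0, sq]
  have hVle : (pathLaw d).real V ≤ wordWeight (pairProb d) k l :=
    (measureReal_mono fun x hx => (⟨T, hx⟩ : x ∈ reachEvent k l u)).trans
      (pathLaw_reachEvent_le hd k l i)
  have hSY : ∀ b, (pathLaw d).real (blockEvent k l u T L b \ globalBlockEvent k l u T L b) ≤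
      8 * C / L * wordWeight (pairProb d) k l := by
    intro b
    have hm1 : pathLaw d (pastHit (2 * L * b + L) L u ∩ shift (2 * L * b + L) ⁻¹' V) ≤
        2 * ρ * pathLaw d V := by
      rw [pathLaw_inter_shift (determinedBefore_pastHit _ _ _) hVdet.measurableSet]
      gcongr
      exact pathLaw_pastHit_le (hρ L (by omega)) _ _
    have hVlate : ∀ v : Lattice d,
        pathLaw d (V ∩ {x | ∃ s, L ≤ s ∧ pos x s = v}) ≤ pathLaw d V * ρ := by
      intro v
      have := pathLaw_inter_late_visit_le (m := T) (g := L - T) (hρ (L - T) (by omega)) hVdet v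
      rwa [show T + (L - T) = L by omega] at this
    have hm2 : pathLaw d (shift (2 * L * b + L) ⁻¹'
        ((V ∩ {x | ∃ s, L ≤ s ∧ pos x s = 0}) ∪ (V ∩ {x | ∃ s, L ≤ s ∧ pos x s = u}))) ≤
        2 * ρ * pathLaw d V := by
      rw [(measurePreserving_shift _).measure_preimage
        ((hVdet.measurableSet.inter (measurableSet_late_visit _ _)).union
          (hVdet.measurableSet.inter (measurableSet_late_visit _ _))).nullMeasurableSet]
      refine (measure_union_le _ _).trans ((add_le_add (hVlate _) (hVlate _)).trans (le_of_eq ?_))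
      ring
    have h3 : pathLaw d (blockEvent k l u T L b \ globalBlockEvent k l u T L b) ≤
        4 * ρ * pathLaw d V := by
      refine (measure_mono (blockEvent_diff_subset k l u (by omega) b)).trans
        ((measure_union_le _ _).trans ((add_le_add hm1 hm2).trans (le_of_eq ?_)))
      ring
    have h4 := ENNReal.toReal_mono (by finiteness) h3
    rw [ENNReal.toReal_mul, ENNReal.toReal_mul, hρdef, ENNReal.toReal_ofReal (by positivity)] at h4
    refine h4.trans ?_
    calc (4 : ℝ≥0∞).toReal * (2 * C / L) * (pathLaw d V).toReal
        = 8 * C / L * (pathLaw d).real V := by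
          rw [measureReal_def, ENNReal.toReal_ofNat]; ring
      _ ≤ _ := by gcongr
  refine (measureReal_iInter_compl_le hK hp0
    (fun b => measurableSet_globalBlockEvent k l u T L b)
    (fun b => globalBlockEvent_subset k l u T L b) hSp hSS hSY).trans ?_
  have hA : 1 / (K * p) ≤ 1 / e ^ 2 * (1 / (K * wordWeight β k l)) := by
    calc 1 / (K * p) ≤ 1 / (K * (e ^ 2 * wordWeight β k l)) := by gcongr
      _ = _ := by field_simp
  have hB : 2 * (8 * C / L * wordWeight (pairProb d) k l) / p ≤
      16 * C / e ^ 2 * (wordWeight (pairProb d) k l / (L * wordWeight β k l)) := by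
    calc 2 * (8 * C / L * wordWeight (pairProb d) k l) / p
        ≤ 2 * (8 * C / L * wordWeight (pairProb d) k l) / (e ^ 2 * wordWeight β k l) := by gcongr
      _ = _ := by field_simp; ring
  have hq1 : 0 ≤ 1 / (K * wordWeight β k l) := by positivity
  have hq2 : 0 ≤ wordWeight (pairProb d) k l / (L * wordWeight β k l) := by positivity
  rw [mul_add]
  exact add_le_add (hA.trans (mul_le_mul_of_nonneg_right (le_max_left _ _) hq1))
    (hB.trans (mul_le_mul_of_nonneg_right (le_max_right _ _) hq2))

end Blocks

/-! ### The lower bound -/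

section LowerBound

variable {d : ℕ}

/-- The event that for some `z` the numbers of visits to `z` and `z + u` are `k + 1` and `l` from
time `N` on. -/
def pairEvent (k l : ℕ) (u : Lattice d) (N : ℕ) : Set (ℕ → Lattice d) :=
  {x | ∃ z, ∀ n, N ≤ n → visits x z n = k + 1 ∧ visits x (z + u) n = l}

lemma compl_pairEvent_subset {k l : ℕ} {u : Lattice d} (hu : u ≠ 0) {T L K N : ℕ} (hL : 0 < L)
    (hT : T ≤ L) (hN : 2 * L * K ≤ N) :
    (pairEvent k l u N)ᶜ ⊆ {x | ∀ b < K, x ∉ globalBlockEvent k l u T L b} := by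
  intro x hx b hb hxb
  refine hx ⟨pos x (2 * L * b + L), fun n hn => visits_of_mem_globalBlockEvent hu hL hxb ?_⟩
  have : 2 * L * (b + 1) ≤ 2 * L * K := Nat.mul_le_mul_left _ hb
  have h2 : 2 * L * (b + 1) = 2 * L * b + 2 * L := by ring
  omega

variable [NeZero d]

/-- A polynomial bound for the probability that no pair of neighbours has given local times. -/
theorem exists_pathLaw_compl_pairEvent_le (hd : 4 ≤ d) {ε : ℝ} (hε : 0 < ε) :
    ∃ (A j₀ : ℕ) (C q : ℝ), 0 < A ∧ 0 ≤ C ∧ 0 ≤ q ∧ q < 1 ∧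
      ∀ (j k l : ℕ) (i : Fin d ⊕ Fin d), j₀ ≤ j →
        rate (pairProb d) k l ≤ (1 - ε / 2) * (A * (j * Real.log 2)) →
        (pathLaw d).real (pairEvent k l (unitVec i) (2 ^ (j * A)))ᶜ ≤
          C * Real.exp (-(Real.log 2 / 2)) ^ j * q ^ (k + l) := by
  set α := pairProb d with hα
  have hα0 : 0 < α := pairProb_pos
  have hα1 : 2 * α < 1 := two_mul_pairProb_lt_one hd
  set c₀ := -Real.log (2 * α) with hc₀
  have hc₀0 : 0 < c₀ := by
    have := Real.log_neg (by positivity) hα1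
    linarith
  -- Blocks have `L = 2 ^ j` and there are `K = 2 ^ (j B)` of them. The slack `ε / 2` in the rate is
  -- then worth at least `8 log L`, so `K` dominates the inverse weight.
  obtain ⟨B, hB⟩ := exists_nat_ge (16 / ε)
  have hBε : 16 ≤ (B : ℝ) * ε := by rwa [div_le_iff₀ hε] at hB
  -- Replacing `α` by `β` costs `exp (-η (k + l))`. As `c₀ (k + l)` is at most the rate, this choice
  -- keeps `η (k + l) ≤ log L / 4`.
  set η := c₀ / (4 * ((B : ℝ) + 2)) with hη
  have hη0 : 0 < η := by positivity
  set β := α * Real.exp (-η) with hβ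
  have hβ0 : 0 < β := by positivity
  have hβα : β < α := mul_lt_of_lt_one_right hα0 (Real.exp_lt_one_iff.2 (by linarith))
  obtain ⟨t, ht⟩ := exists_le_pathLaw_firstVisit hd hβα
  obtain ⟨C₁, hC₁, hblock⟩ := exists_pathLaw_no_block_le hd
  obtain ⟨C₂, hC₂, hweight⟩ := exists_exp_neg_rate_le hα0 hη0
  have hlog2 : 0 < Real.log 2 := Real.log_pos one_lt_two
  -- The time `(k + l) t` needed for the visits is linear in `j`, hence eventually at most `L / 2`.
  obtain ⟨j₁, hj₁⟩ : ∃ j₁ : ℕ, ∀ j, j₁ ≤ j →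
      2 * t * (j * Real.log 2 / (4 * η)) ≤ (2 : ℝ) ^ j := by
    have h := tendsto_pow_const_div_const_pow_of_one_lt 1 (one_lt_two (α := ℝ))
    have hc : 0 < 1 / (2 * t * (Real.log 2 / (4 * η)) + 1) := by positivity
    obtain ⟨j₁, hj₁⟩ := Filter.eventually_atTop.1 (h.eventually (gt_mem_nhds hc))
    refine ⟨j₁, fun j hj => ?_⟩
    have h1 := hj₁ j hj
    rw [div_lt_div_iff₀ (by positivity) (by positivity), pow_one, one_mul] at h1
    have hj0 : (0 : ℝ) ≤ j := Nat.cast_nonneg j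
    calc 2 * t * (j * Real.log 2 / (4 * η)) = j * (2 * t * (Real.log 2 / (4 * η)) + 1) - j := by
          ring
      _ ≤ (2 : ℝ) ^ j := by linarith
  refine ⟨B + 2, max j₁ 1, C₁ * (C₂ + 1), Real.exp (-η), by omega, by positivity,
    Real.exp_nonneg _, Real.exp_lt_one_iff.2 (by linarith), ?_⟩
  intro j k l i hj hrate
  have hj1 : 1 ≤ j := (le_max_right _ _).trans hj
  push_cast at hrate
  set lam := (j : ℝ) * Real.log 2 with hlam
  have hlam0 : 0 ≤ lam := by positivity
  set s := (k : ℝ) + l with hs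
  have hs0 : 0 ≤ s := by positivity
  have h2pow : ∀ m : ℕ, (2 : ℝ) ^ (j * m) = Real.exp (m * lam) := by
    intro m
    rw [pow_mul, Real.exp_nat_mul, hlam, Real.exp_nat_mul, Real.exp_log two_pos]
  have hrate1 : rate α k l ≤ ((B : ℝ) + 2) * lam - 8 * lam := by
    refine hrate.trans ?_
    have h1 : 16 * lam ≤ B * ε * lam := by gcongr
    have h2 : 0 ≤ ε * lam := by positivity
    have h3 : (1 - ε / 2) * (((B : ℝ) + 2) * lam) =
      ((B : ℝ) + 2) * lam - B * ε * lam / 2 - ε * lam := by ring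
    linarith
  have hηs : η * s ≤ lam / 4 := by
    have h1 : c₀ * s ≤ rate α k l := mul_add_le_rate hα0 (by positivity) (by positivity)
    have h2 : c₀ * s ≤ ((B : ℝ) + 2) * lam := by linarith
    rw [hη, div_mul_eq_mul_div, div_le_div_iff₀ (by positivity) (by norm_num)]
    linarith
  have hT : 2 * ((k + l) * t) ≤ 2 ^ j := by
    have h1 := hj₁ j ((le_max_left _ _).trans hj)
    have h2 : s ≤ lam / (4 * η) := by
      rw [le_div_iff₀ (by positivity)]; linarith
    have h3 : 2 * (s * t) ≤ (2 : ℝ) ^ j := by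
      refine le_trans ?_ h1
      calc 2 * (s * t) = 2 * t * s := by ring
        _ ≤ _ := by gcongr
    rw [hs] at h3
    exact_mod_cast h3
  have hN : 2 * 2 ^ j * 2 ^ (j * B) ≤ 2 ^ (j * (B + 2)) := by
    rw [mul_assoc, ← pow_add, ← pow_succ']
    exact Nat.pow_le_pow_right (by norm_num) (by rw [mul_add]; omega)
  have hmain := hblock hβ0 ht k l (2 ^ j) (2 ^ (j * B)) i (by positivity) (by positivity) hT
  refine (measureReal_mono (compl_pairEvent_subset (unitVec_ne_zero i) (by positivity)
    (by omega) hN)).trans (hmain.trans ?_)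
  have hwβ : wordWeight β k l = wordWeight α k l * Real.exp (-(η * s)) := by
    have h1 : Real.exp (-(η * s)) = Real.exp (-η) ^ (k + l) := by
      rw [← Real.exp_nat_mul, hs]; congr 1; push_cast; ring
    rw [h1]
    unfold wordWeight
    rw [hβ, mul_pow]; ring
  have hwα : 0 < wordWeight α k l := by
    have : 0 < (k + l).choose k := Nat.choose_pos (by omega)
    unfold wordWeight
    positivity
  have hq : Real.exp (-(Real.log 2 / 2)) ^ j * Real.exp (-η) ^ (k + l) =
      Real.exp (-(lam / 2) - η * s) := by
    rw [← Real.exp_nat_mul, ← Real.exp_nat_mul, ← Real.exp_add]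
    congr 1
    rw [hlam, hs]
    push_cast
    ring
  rw [mul_assoc, hq, mul_assoc]
  refine mul_le_mul_of_nonneg_left ?_ hC₁.le
  rw [add_mul, one_mul]
  refine add_le_add ?_ ?_
  · push_cast
    rw [h2pow, hwβ, div_le_iff₀ (by positivity)]
    have h1 := hweight k l
    calc (1 : ℝ) ≤ Real.exp (-(lam / 2) - η * s + B * lam - η * s + rate α k l + η * s -
            rate α k l - η * s + (lam / 2 + 2 * (η * s) - B * lam)) := by
          rw [Real.one_le_exp_iff]; linarith
      _ ≤ Real.exp (-(lam / 2) - η * s + B * lam - η * s + (-rate α k l - η * s)) := by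
          rw [Real.exp_le_exp]; linarith
      _ = Real.exp (-(lam / 2) - η * s) * (Real.exp (B * lam) * Real.exp (-(η * s))) *
            Real.exp (-rate α k l - η * s) := by
          rw [← Real.exp_add, ← Real.exp_add, ← Real.exp_add]; congr 1; ring
      _ ≤ Real.exp (-(lam / 2) - η * s) * (Real.exp (B * lam) * Real.exp (-(η * s))) *
            (C₂ * wordWeight α k l) := by gcongr
      _ = _ := by ring
  · push_cast
    have h2 : (2 : ℝ) ^ j = Real.exp lam := by
      have := h2pow 1
      simpa using this
    rw [h2, hwβ, div_le_iff₀ (by positivity)]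
    calc wordWeight α k l = wordWeight α k l * 1 := by ring
      _ ≤ wordWeight α k l * Real.exp (-(lam / 2) - η * s + lam - η * s) := by
          gcongr
          rw [Real.one_le_exp_iff]; linarith
      _ = wordWeight α k l *
          (Real.exp (-(lam / 2) - η * s) * (Real.exp lam * Real.exp (-(η * s)))) := by
          rw [← Real.exp_add, ← Real.exp_add]; congr 2; ring
      _ = _ := by ring

/-- Almost surely, every pair of numbers of visits in the region `(1 - ε) log n • 𝓑` is realised,
up to time `n`, by some pair of neighbours in every given direction, for all large `n`. -/
theorem ae_eventually_exists_visits_eq (hd : 4 ≤ d) {ε : ℝ} (hε : 0 < ε) (hε1 : ε < 1) :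
    ∀ᵐ x ∂pathLaw d, ∃ n₀ : ℕ, ∀ n : ℕ, n₀ ≤ n → ∀ (k l : ℕ) (i : Fin d ⊕ Fin d),
      rate (pairProb d) k l ≤ (1 - ε) * Real.log n →
        ∃ z, visits x z n = k + 1 ∧ visits x (z + unitVec i) n = l := by
  classical
  obtain ⟨A, j₀, C, q, hA, hC, hq0, hq1, hbound⟩ := exists_pathLaw_compl_pairEvent_le hd hε
  have hlog2 : 0 < Real.log 2 := Real.log_pos one_lt_two
  let E : ℕ × ℕ × ℕ × (Fin d ⊕ Fin d) → Set (ℕ → Lattice d) := fun t =>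
    if j₀ ≤ t.1 ∧ rate (pairProb d) t.2.1 t.2.2.1 ≤
        (1 - ε / 2) * (A * (t.1 * Real.log 2)) then
      (pairEvent t.2.1 t.2.2.1 (unitVec t.2.2.2) (2 ^ (t.1 * A)))ᶜ else ∅
  have hsum : ∑' t, pathLaw d (E t) ≠ ∞ := by
    refine tsum_ne_top_of_le (a := fun j : ℕ => Real.exp (-(Real.log 2 / 2)) ^ j) (C := C) (q := q)
      hC (fun j => by positivity) (summable_geometric_of_lt_one (Real.exp_nonneg _)
        (Real.exp_lt_one_iff.2 (by linarith))) hq0 hq1 ?_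
    intro j k l i
    simp only [E]
    split_ifs with hcond
    · rw [← ENNReal.ofReal_toReal (measure_ne_top (pathLaw d) _), ← measureReal_def]
      exact ENNReal.ofReal_le_ofReal (hbound j k l i hcond.1 hcond.2)
    · simp
  filter_upwards [ae_finite_setOfPred_mem hsum] with x hx
  obtain ⟨J, hJ⟩ := (hx.image fun t => t.1).bddAbove
  obtain ⟨M, hM⟩ := exists_nat_ge (2 / ε)
  refine ⟨(2 ^ A) ^ (max j₀ (max (J + 1) M)), fun n hn k l i hrate => ?_⟩
  have hb : 1 < 2 ^ A := Nat.one_lt_two_pow hA.ne'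
  set j := Nat.log (2 ^ A) n with hj
  have hn0 : n ≠ 0 := by
    have : 0 < (2 ^ A) ^ (max j₀ (max (J + 1) M)) := by positivity
    omega
  have hjle : max j₀ (max (J + 1) M) ≤ j := Nat.le_log_of_pow_le hb hn
  have hj0 : j₀ ≤ j := (le_max_left _ _).trans hjle
  have hjJ : J + 1 ≤ j := ((le_max_left _ _).trans (le_max_right _ _)).trans hjle
  have hjM : M ≤ j := ((le_max_right _ _).trans (le_max_right _ _)).trans hjle
  have hlow : (2 ^ A) ^ j ≤ n := Nat.pow_log_le_self _ hn0
  have hup : n < (2 ^ A) ^ (j + 1) := Nat.lt_pow_succ_log_self hb n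
  have hlogn : Real.log n ≤ A * ((j + 1) * Real.log 2) := by
    have h1 : (n : ℝ) ≤ ((2 : ℝ) ^ A) ^ (j + 1) := by exact_mod_cast hup.le
    have hn1 : (0 : ℝ) < n := by exact_mod_cast Nat.pos_of_ne_zero hn0
    refine (Real.log_le_log hn1 h1).trans (le_of_eq ?_)
    rw [Real.log_pow, Real.log_pow]
    push_cast
    ring
  have hcond : rate (pairProb d) k l ≤ (1 - ε / 2) * (A * (j * Real.log 2)) := by
    have hjε : 2 ≤ ε * j := by
      have : 2 / ε ≤ j := hM.trans (by exact_mod_cast hjM)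
      rw [div_le_iff₀ hε] at this
      linarith
    -- Rounding `n` down to a power of `2 ^ A` costs a factor `(j + 1) / j`, paid by half of `ε`
    -- once `j ≥ 2 / ε`.
    have h1 : (1 - ε) * (j + 1) ≤ (1 - ε / 2) * j := by nlinarith
    calc rate (pairProb d) k l ≤ (1 - ε) * Real.log n := hrate
      _ ≤ (1 - ε) * (A * ((j + 1) * Real.log 2)) := by
          have : 0 ≤ 1 - ε := by linarith
          gcongr
      _ = ((1 - ε) * (j + 1)) * (A * Real.log 2) := by ring
      _ ≤ ((1 - ε / 2) * j) * (A * Real.log 2) := by gcongr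
      _ = _ := by ring
  by_contra hcon
  have hmem : (j, k, l, i) ∈ {t | x ∈ E t} := by
    change x ∈ E (j, k, l, i)
    simp only [E]
    rw [if_pos ⟨hj0, hcond⟩]
    rintro ⟨z, hz⟩
    -- The counts in `pairEvent` hold at all later times, hence at `n` itself.
    exact hcon ⟨z, hz n (by rwa [mul_comm, pow_mul])⟩
  have : j ≤ J := hJ ⟨_, hmem, rfl⟩
  omega

end LowerBound

/-! ### Transfer to the given walk -/

lemma IsSimpleWalkSteps.pairProb_eq {d : ℕ} [NeZero d] {Ω : Type*} [MeasurableSpace Ω]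
    {μ : Measure Ω} [IsProbabilityMeasure μ] {X : ℕ → Ω → Lattice d}
    (hX : IsSimpleWalkSteps μ X) :
    (1 - escapeProb μ X) / (2 - escapeProb μ X) = pairProb d := by
  have hmeas : Measurable fun ω k => X k ω := measurable_pi_lambda _ hX.measurable
  have h : escapeProb μ X = 1 - (pathLaw d).real (hitEvent 0) := by
    rw [← probReal_compl_eq_one_sub (measurableSet_hitEvent 0), ← hX.map_eq_pathLaw,
      map_measureReal_apply hmeas (measurableSet_hitEvent 0).compl]
    unfold escapeProb
    congr 1
    ext ω
    simp only [hitEvent, Set.mem_ofPred_eq, Set.mem_preimage, Set.mem_compl_iff, not_exists,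
      not_and]
    rfl
  rw [h]
  unfold pairProb
  ring_nf

end LocalTimes

end

theorem theorem1p1 {d : ℕ} (hd : 4 ≤ d) {Ω : Type*} [MeasurableSpace Ω] (μ : Measure Ω)
    [IsProbabilityMeasure μ] (X : ℕ → Ω → LocalTimes.Lattice d)
    (hX : LocalTimes.IsSimpleWalkSteps μ X) (ε : ℝ) (hε : 0 < ε) :
    ∀ᵐ ω ∂μ, ∃ n₀ : ℕ, ∀ n : ℕ, n₀ ≤ n →
      (∀ (z : LocalTimes.Lattice d) (i : Fin d ⊕ Fin d),
        ((LocalTimes.localTime X z n ω : ℝ),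
            (LocalTimes.localTime X (z + LocalTimes.unitVec i) n ω : ℝ)) ∈
          ((1 + ε) * Real.log (n : ℝ)) •
            LocalTimes.regionB (LocalTimes.escapeProb μ X)) ∧
      (∀ k l : ℕ,
        ((k : ℝ), (l : ℝ)) ∈
          ((1 - ε) * Real.log (n : ℝ)) •
            LocalTimes.regionB (LocalTimes.escapeProb μ X) →
        ∀ i : Fin d ⊕ Fin d, ∃ z₁ z₂ : LocalTimes.Lattice d,
          (LocalTimes.localTime X z₁ n ω = k + 1 ∧
            LocalTimes.localTime X (z₁ + LocalTimes.unitVec i) n ω = l) ∧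
          (LocalTimes.localTime X z₂ n ω = k ∧
            LocalTimes.localTime X (z₂ + LocalTimes.unitVec i) n ω = l + 1)) := by
  have : NeZero d := ⟨by omega⟩
  have hα := hX.pairProb_eq
  have hmeas : Measurable fun ω k => X k ω := measurable_pi_lambda _ hX.measurable
  -- The lower bound requires `ε < 1`; `min ε (1 / 2)` only enlarges the region of admissible
  -- counts.
  have hae : ∀ᵐ x ∂μ.map (fun ω k => X k ω), (∃ n₀ : ℕ, ∀ n : ℕ, n₀ ≤ n →
      ∀ (z : LocalTimes.Lattice d) (i : Fin d ⊕ Fin d),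
        LocalTimes.rate (LocalTimes.pairProb d) (LocalTimes.visits x z n)
          (LocalTimes.visits x (z + LocalTimes.unitVec i) n) ≤ (1 + ε) * Real.log n) ∧
      ∃ n₀ : ℕ, ∀ n : ℕ, n₀ ≤ n → ∀ (k l : ℕ) (i : Fin d ⊕ Fin d),
        LocalTimes.rate (LocalTimes.pairProb d) k l ≤ (1 - min ε (1 / 2)) * Real.log n →
          ∃ z, LocalTimes.visits x z n = k + 1 ∧
            LocalTimes.visits x (z + LocalTimes.unitVec i) n = l := by
    rw [hX.map_eq_pathLaw]
    exact (LocalTimes.ae_eventually_rate_visits_le hd hε).and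
      (LocalTimes.ae_eventually_exists_visits_eq hd (lt_min hε (by norm_num))
        ((min_le_right _ _).trans_lt (by norm_num)))
  filter_upwards [ae_of_ae_map hmeas.aemeasurable hae] with ω hω
  obtain ⟨⟨n₁, h₁⟩, n₂, h₂⟩ := hω
  refine ⟨max 2 (max n₁ n₂), fun n hn => ?_⟩
  have hn2 : 2 ≤ n := (le_max_left _ _).trans hn
  have hn₁ : n₁ ≤ n := ((le_max_left _ _).trans (le_max_right _ _)).trans hn
  have hn₂ : n₂ ≤ n := ((le_max_right _ _).trans (le_max_right _ _)).trans hn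
  have hlog : 0 < Real.log n := Real.log_pos (by exact_mod_cast hn2)
  refine ⟨fun z i => ?_, fun k l hkl i => ?_⟩
  · rw [LocalTimes.mem_smul_regionB (by positivity) (by positivity) (by positivity), hα]
    exact h₁ n hn₁ z i
  · have hrate : LocalTimes.rate (LocalTimes.pairProb d) k l ≤
        (1 - min ε (1 / 2)) * Real.log n := by
      have h := LocalTimes.rate_le_of_mem_smul_regionB (by positivity) (by positivity) hkl
      rw [hα] at h
      refine h.trans (max_le ?_ ?_)
      · gcongr
        exact min_le_left _ _
      · have := min_le_right ε (1 / 2)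
        exact mul_nonneg (by linarith) hlog.le
    obtain ⟨z, hz⟩ := h₂ n hn₂ k l i hrate
    -- For the second pair the roles are exchanged: `w` gets `l + 1` visits and its neighbour in the
    -- opposite direction gets `k`, so that neighbour serves as `z₂`.
    obtain ⟨w, hw⟩ := h₂ n hn₂ l k i.swap (by rwa [LocalTimes.rate_comm])
    refine ⟨z, w - LocalTimes.unitVec i, hz, ?_, ?_⟩
    · rw [LocalTimes.unitVec_swap, ← sub_eq_add_neg] at hw
      exact hw.2
    · rw [sub_add_cancel]
      exact hw.1
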